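/- Let $1<p<\infty$ and put $\lambda_p=\dfrac{(2\pi)^p(p-1)}{[p\sin(\pi/p)]^p}$. There is exactly one function $\omega:\mathbb R\to\mathbb R$ such that $\omega$ and $|\omega'|^{p-2}\omega'$ are differentiable on $\mathbb R$ and $$-\left(|\omega'|^{p-2}\omega'\right)'=|\omega|^{p-2}\omega\ \text{ in }\mathbb R,\qquad \omega(0)=0,\quad \omega'(0)=1$$ (where $|x|^{p-2}x:=0$ for $x=0$). Let $N\in\mathbb N$, $\Lambda>0$, and suppose that $\mathbf u\not\equiv 0$, with values in $\mathbb R^N$, solves $$-\left(|\mathbf u'|^{p-2}\mathbf u'\right)'=\Lambda|\mathbf u|^{p-2}\mathbf u\ \text{ in }(0,1),\qquad \mathbf u(0)=\mathbf u(1)=0,$$ either classically ($\mathbf u$ is continuous on $[0,1]$ and vanishes at $0$ and $1$, $\mathbf u$ and $|\mathbf u'|^{p-2}\mathbf u'$ are differentiable in $(0,1)$, and the equation holds at every point of $(0,1)$) or weakly ($\mathbf u\in W^{1,p}_0((0,1);\mathbb R^N)$, the closure of $C_c^\infty((0,1);\mathbb R^N)$ in $W^{1,p}$, and $\int_0^1|\mathbf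 u'|^{p-2}\mathbf u'\cdot\varphi'\,dt=\Lambda\int_0^1|\mathbf u|^{p-2}\mathbf u\cdot\varphi\,dt$ for all $\varphi\in C_c^\infty((0,1);\mathbb R^N)$). Then $\Lambda=k^p\lambda_p$ for some integer $k\ge 1$, and there is $\mathbf c\in\mathbb R^N$ with $$\mathbf u(t)=\frac{\mathbf c}{\Lambda^{1/p}}\,\omega\!\left(\Lambda^{1/p}t\right)$$ for all $t\in[0,1]$ if $\mathbf u$ is a classical solution, and for almost every $t\in(0,1)$ if it is a weak one. Moreover $t\mapsto\omega(\Lambda^{1/p}t)$ is itself a (classical, respectively weak) solution of the same problem with $N=1$ and the same $\Lambda$; so every eigenfunction, not only every minimizer, is a constant vector times a scalar eigenfunction. -/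

import Mathlib

open MeasureTheory Set Filter Topology

namespace VectorPLaplace

variable {E : Type*} [NormedAddCommGroup E] [InnerProductSpace ℝ E]

/-- The map `x ↦ |x|^(p-2) x`. For `p > 1` it takes the value `0` at `x = 0`, whatever the value
of the real power `0 ^ (p - 2)`, so it is the usual continuous map. -/
noncomputable def phi (p : ℝ) (x : E) : E := ‖x‖ ^ (p - 2) • x

/-- The number `λ_p = (2π)^p (p - 1) / (p sin (π / p))^p`. -/
noncomputable def lam (p : ℝ) : ℝ :=
  (2 * Real.pi) ^ p * (p - 1) / (p * Real.sin (Real.pi / p)) ^ p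

/-- `ω : ℝ → ℝ` is a solution on the whole line of
`-(|ω'|^(p-2) ω')' = |ω|^(p-2) ω`, `ω(0) = 0`, `ω'(0) = 1`. -/
structure IsOmega (p : ℝ) (ω : ℝ → ℝ) : Prop where
  differentiable : Differentiable ℝ ω
  ode : ∀ t : ℝ, HasDerivAt (fun s => phi p (deriv ω s)) (-phi p (ω t)) t
  zero : ω 0 = 0
  deriv_zero : deriv ω 0 = 1

/-- Classical solutions of `-(|u'|^(p-2) u')' = Λ |u|^(p-2) u` in `(0,1)`, `u(0) = u(1) = 0`.
Only the values of `u` on `[0,1]` matter. -/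
structure IsClassicalSolution (p Λ : ℝ) (u : ℝ → E) : Prop where
  continuousOn : ContinuousOn u (Icc 0 1)
  differentiableAt : ∀ t ∈ Ioo (0 : ℝ) 1, DifferentiableAt ℝ u t
  ode : ∀ t ∈ Ioo (0 : ℝ) 1, HasDerivAt (fun s => phi p (deriv u s)) (-(Λ • phi p (u t))) t
  left : u 0 = 0
  right : u 1 = 0

/-- Test functions: `C_c^∞((0,1); E)`. -/
structure IsTestFunction (φ : ℝ → E) : Prop where
  smooth : ContDiff ℝ (⊤ : ℕ∞) φ
  hasCompactSupport : HasCompactSupport φ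
  tsupport_subset : tsupport φ ⊆ Ioo 0 1

/-- Lebesgue measure on the interval `(0,1)`. -/
noncomputable def unitMeasure : Measure ℝ := volume.restrict (Ioo 0 1)

/-- `g` is the weak derivative of `u` in `(0,1)`. -/
structure HasWeakDeriv (u g : ℝ → E) : Prop where
  locallyIntegrableOn : LocallyIntegrableOn u (Ioo 0 1)
  locallyIntegrableOn_deriv : LocallyIntegrableOn g (Ioo 0 1)
  integral_eq : ∀ φ : ℝ → ℝ, IsTestFunction φ →
    ∫ t, deriv φ t • u t ∂unitMeasure = -∫ t, φ t • g t ∂unitMeasure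

/-- `u` belongs to `W_0^{1,p}((0,1); E)`, the closure of the test functions in `W^{1,p}`, and its
weak derivative is `g`. -/
structure MemSobolevZero (p : ℝ) (u g : ℝ → E) : Prop where
  memLp : MemLp u (ENNReal.ofReal p) unitMeasure
  memLp_deriv : MemLp g (ENNReal.ofReal p) unitMeasure
  hasWeakDeriv : HasWeakDeriv u g
  approx : ∃ φ : ℕ → ℝ → E, (∀ n, IsTestFunction (φ n)) ∧
    Tendsto (fun n => eLpNorm (fun t => φ n t - u t) (ENNReal.ofReal p) unitMeasure)
      atTop (𝓝 0) ∧
    Tendsto (fun n => eLpNorm (fun t => deriv (φ n) t - g t) (ENNReal.ofReal p) unitMeasure)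
      atTop (𝓝 0)

/-- Weak solutions `u ∈ W_0^{1,p}((0,1); E)` of the Dirichlet eigenvalue problem:
`∫ |u'|^(p-2) u' · φ' = Λ ∫ |u|^(p-2) u · φ` for all test functions `φ`. -/
def IsWeakSolution (p Λ : ℝ) (u : ℝ → E) : Prop :=
  ∃ g : ℝ → E, MemSobolevZero p u g ∧ ∀ φ : ℝ → E, IsTestFunction φ →
    ∫ t, inner ℝ (phi p (g t)) (deriv φ t) ∂unitMeasure =
      Λ * ∫ t, inner ℝ (phi p (u t)) (φ t) ∂unitMeasure

end VectorPLaplace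

/-!
Put `w = |u'|^(p-2) u'`, and let `q` be the exponent conjugate to `p`. The equation becomes the
Hamiltonian system `u' = φ_q(w)`, `w' = -Λ φ_p(u)` with `φ_p(x) = |x|^(p-2) x`, whose energy
`|w|^q / q + Λ |u|^p / p` is conserved. One of `φ_p`, `φ_q` fails to be Lipschitz at the origin, but
initial value problems are uniquely solvable: if `u(a) = 0` and `w(a) ≠ 0`, then `u` grows linearly
near `a`, so along two such solutions `φ_p` has Lipschitz constant `O(1 / (t - a))`, and this is
enough because their difference is `O(t - a)`. A solution with `u(0) = 0` is determined by the
vector `w(0)`, and by homogeneity the scalar solution `ω`, rescaled, times a constant vector has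
the same initial data; hence every solution is of this form.

The scalar solution is explicit in an angle `θ` on the energy level curve. The time needed to turn
by `θ` is the integral of a `π`-periodic density, so the zeros of `ω` are the multiples of the
integral over one half-turn, a Beta integral whose value is `λ_p ^ (1 / p)`.

By the lemma of du Bois-Reymond, a weak solution agrees almost everywhere with a solution of the
same system.
-/

namespace VectorPLaplace

variable {E : Type*} [NormedAddCommGroup E] [InnerProductSpace ℝ E]

section Phi

@[simp] lemma phi_zero (p : ℝ) : phi p (0 : E) = 0 := by simp [phi]

lemma phi_neg (p : ℝ) (x : E) : phi p (-x) = -phi p x := by simp [phi]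

lemma phi_two (x : E) : phi 2 x = x := by simp [phi]

lemma phi_one_real (p : ℝ) : phi p (1 : ℝ) = 1 := by simp [phi]

lemma phi_smul (p r : ℝ) (x : E) : phi p (r • x) = phi p r • phi p x := by
  simp only [phi, norm_smul, Real.mul_rpow (norm_nonneg r) (norm_nonneg x), smul_smul, smul_eq_mul]
  congr 1
  ring

lemma norm_phi_of_ne_zero (p : ℝ) {x : E} (hx : x ≠ 0) : ‖phi p x‖ = ‖x‖ ^ (p - 1) := by
  rw [phi, norm_smul, Real.norm_of_nonneg (by positivity), show p - 1 = p - 2 + 1 by ring,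
    Real.rpow_add_one (norm_ne_zero_iff.2 hx)]

lemma norm_phi {p : ℝ} (hp : 1 < p) (x : E) : ‖phi p x‖ = ‖x‖ ^ (p - 1) := by
  rcases eq_or_ne x 0 with rfl | hx
  · simp [Real.zero_rpow (sub_pos.2 hp).ne']
  · exact norm_phi_of_ne_zero p hx

lemma phi_of_pos (p : ℝ) {r : ℝ} (hr : 0 < r) : phi p r = r ^ (p - 1) := by
  rw [phi, Real.norm_of_nonneg hr.le, smul_eq_mul, show p - 1 = p - 2 + 1 by ring,
    Real.rpow_add_one hr.ne']

lemma phi_phi (a b : ℝ) (x : E) : phi a (phi b x) = phi ((a - 1) * (b - 1) + 1) x := by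
  rcases eq_or_ne x 0 with rfl | hx
  · simp
  · have hpos : 0 < ‖x‖ := norm_pos_iff.2 hx
    rw [phi, norm_phi_of_ne_zero b hx, phi, phi, smul_smul, ← Real.rpow_mul hpos.le,
      ← Real.rpow_add hpos]
    congr 2
    ring

lemma phi_phi_of_holderConjugate {p q : ℝ} (hpq : p.HolderConjugate q) (x : E) :
    phi p (phi q x) = x := by
  have h : (p - 1) * (q - 1) = 1 := by linear_combination hpq.mul_eq_add
  rw [phi_phi, h, one_add_one_eq_two, phi_two]

lemma phi_eq_zero {p : ℝ} {x : E} : phi p x = 0 ↔ x = 0 := by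
  refine ⟨fun h => ?_, fun h => by rw [h, phi_zero]⟩
  by_contra hx
  have hpos : 0 < ‖x‖ ^ (p - 2) := Real.rpow_pos_of_pos (norm_pos_iff.2 hx) _
  exact smul_ne_zero hpos.ne' hx h

lemma contDiffAt_phi (p : ℝ) {x : E} (hx : x ≠ 0) : ContDiffAt ℝ 1 (phi p) x :=
  ((contDiffAt_norm ℝ hx).rpow_const_of_ne (norm_ne_zero_iff.2 hx)).smul contDiffAt_id

lemma continuous_phi {p : ℝ} (hp : 1 < p) : Continuous (phi p : E → E) := by
  refine continuous_iff_continuousAt.2 fun x => ?_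
  rcases eq_or_ne x 0 with rfl | hx
  · have hlim : ContinuousAt (fun y : E => ‖y‖ ^ (p - 1)) 0 :=
      continuous_norm.continuousAt.rpow_const (Or.inr (sub_pos.2 hp).le)
    rw [ContinuousAt, phi_zero, tendsto_zero_iff_norm_tendsto_zero]
    simpa only [norm_phi hp, ContinuousAt, norm_zero, Real.zero_rpow (sub_pos.2 hp).ne'] using hlim
  · exact (contDiffAt_phi p hx).continuousAt

lemma exists_eventually_norm_phi_sub_le {ι : Type*} {l : Filter ι} {f g : ι → E} {x : E} (p : ℝ)
    (hx : x ≠ 0) (hf : Tendsto f l (𝓝 x)) (hg : Tendsto g l (𝓝 x)) :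
    ∃ K : ℝ, 0 ≤ K ∧ ∀ᶠ t in l, ‖phi p (f t) - phi p (g t)‖ ≤ K * ‖f t - g t‖ := by
  obtain ⟨K, s, hs, hK⟩ := (contDiffAt_phi p hx).exists_lipschitzOnWith
  refine ⟨K, K.2, ?_⟩
  filter_upwards [hf hs, hg hs] with t hft hgt using hK.norm_sub_le hft hgt

end Phi

/-! ### Uniqueness for the first-order system -/

section Flow

/-- `(u, w)` solves on `s` the first-order form `u' = α φ_q(w)`, `w' = -β φ_p(u)` of the
`p`-Laplace equation, the derivatives being taken within `s`. Both constants are there to make the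
system invariant under `(u, w) ↦ (w, -u)`. -/
structure IsFlow (p q α β : ℝ) (s : Set ℝ) (u w : ℝ → E) : Prop where
  deriv_fst : ∀ t ∈ s, HasDerivWithinAt u (α • phi q (w t)) s t
  deriv_snd : ∀ t ∈ s, HasDerivWithinAt w (-(β • phi p (u t))) s t

variable {p q α β a b : ℝ} {s : Set ℝ} {u w u₁ w₁ u₂ w₂ : ℝ → E}

namespace IsFlow

lemma continuousOn_fst (h : IsFlow p q α β s u w) : ContinuousOn u s :=
  fun t ht => (h.deriv_fst t ht).continuousWithinAt

lemma continuousOn_snd (h : IsFlow p q α β s u w) : ContinuousOn w s :=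
  fun t ht => (h.deriv_snd t ht).continuousWithinAt

lemma mono (h : IsFlow p q α β s u w) {s' : Set ℝ} (hs : s' ⊆ s) : IsFlow p q α β s' u w where
  deriv_fst t ht := (h.deriv_fst t (hs ht)).mono hs
  deriv_snd t ht := (h.deriv_snd t (hs ht)).mono hs

lemma swap (h : IsFlow p q α β s u w) : IsFlow q p β α s w (fun t => -u t) where
  deriv_fst t ht := by simpa only [phi_neg, smul_neg] using h.deriv_snd t ht
  deriv_snd t ht := (h.deriv_fst t ht).fun_neg

lemma reflect (h : IsFlow p q α β univ u w) :
    IsFlow p q α β univ (fun t => -u (-t)) (fun t => w (-t)) where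
  deriv_fst t _ := by
    have hu := (h.deriv_fst (-t) trivial).hasDerivAt univ_mem
    simpa using (HasDerivAt.scomp t hu (hasDerivAt_neg t)).fun_neg
  deriv_snd t _ := by
    have hw := (h.deriv_snd (-t) trivial).hasDerivAt univ_mem
    simpa [phi_neg, Function.comp_def] using HasDerivAt.scomp t hw (hasDerivAt_neg t)

lemma energy_eq (h : IsFlow p q α β s u w) (hp : 1 < p) (hq : 1 < q) (hs : Convex ℝ s) {t r : ℝ}
    (ht : t ∈ s) (hr : r ∈ s) :
    α / q * ‖w t‖ ^ q + β / p * ‖u t‖ ^ p = α / q * ‖w r‖ ^ q + β / p * ‖u r‖ ^ p := by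
  have hderiv : ∀ x ∈ s, HasDerivWithinAt
      (fun t => α / q * ‖w t‖ ^ q + β / p * ‖u t‖ ^ p) 0 s x := by
    intro x hx
    have hw := ((hasFDerivAt_norm_rpow (w x) hq).comp_hasDerivWithinAt x
      (h.deriv_snd x hx)).const_mul (α / q)
    have hu := ((hasFDerivAt_norm_rpow (u x) hp).comp_hasDerivWithinAt x
      (h.deriv_fst x hx)).const_mul (β / p)
    convert! hw.add hu using 1
    have hp0 : p ≠ 0 := by positivity
    have hq0 : q ≠ 0 := by positivity
    simp only [phi, _root_.smul_apply, innerSL_apply_apply, inner_neg_right, inner_smul_right,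
      smul_eq_mul, real_inner_comm (u x) (w x)]
    field_simp
    ring
  have hconst := hs.norm_image_sub_le_of_norm_hasDerivWithin_le (C := 0) hderiv
    (fun _ _ => norm_zero.le) hr ht
  rw [zero_mul] at hconst
  exact sub_eq_zero.1 (norm_le_zero_iff.1 hconst)

lemma eq_zero_of_eq_zero (h : IsFlow p q α β s u w) (hp : 1 < p) (hq : 1 < q) (hα : 0 < α)
    (hβ : 0 < β) (hs : Convex ℝ s) {t r : ℝ} (hr : r ∈ s) (hur : u r = 0) (hwr : w r = 0)
    (ht : t ∈ s) : u t = 0 ∧ w t = 0 := by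
  have hp0 : 0 < p := by positivity
  have hq0 : 0 < q := by positivity
  have henergy := h.energy_eq hp hq hs ht hr
  rw [hur, hwr, norm_zero, Real.zero_rpow hq0.ne', Real.zero_rpow hp0.ne', mul_zero,
    mul_zero, add_zero, add_eq_zero_iff_of_nonneg (by positivity) (by positivity)] at henergy
  simpa [hp0.ne', hq0.ne', hα.ne', hβ.ne', Real.rpow_eq_zero, and_comm] using henergy

lemma norm_fst_sub_le (h₁ : IsFlow p q α β (Icc a b) u₁ w₁) (h₂ : IsFlow p q α β (Icc a b) u₂ w₂)
    (hu : u₁ a = u₂ a) {C : ℝ} (hC : ∀ t ∈ Icc a b, ‖phi q (w₁ t) - phi q (w₂ t)‖ ≤ C) {t : ℝ}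
    (ht : t ∈ Icc a b) : ‖u₁ t - u₂ t‖ ≤ |α| * C * (t - a) := by
  have hbound := norm_image_sub_le_of_norm_deriv_le_segment' (f := fun t => u₁ t - u₂ t)
    (C := |α| * C) (fun r hr => (h₁.deriv_fst r hr).fun_sub (h₂.deriv_fst r hr)) (fun r hr => by
      rw [← smul_sub, norm_smul, Real.norm_eq_abs]
      exact mul_le_mul_of_nonneg_left (hC r (Ico_subset_Icc_self hr)) (abs_nonneg α)) t ht
  simpa [hu] using hbound

lemma norm_snd_sub_le (h₁ : IsFlow p q α β (Icc a b) u₁ w₁) (h₂ : IsFlow p q α β (Icc a b) u₂ w₂)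
    (hw : w₁ a = w₂ a) {C : ℝ} (hC : ∀ t ∈ Icc a b, ‖phi p (u₁ t) - phi p (u₂ t)‖ ≤ C) {t : ℝ}
    (ht : t ∈ Icc a b) : ‖w₁ t - w₂ t‖ ≤ |β| * C * (t - a) :=
  h₁.swap.norm_fst_sub_le h₂.swap hw
    (fun r hr => by simpa only [phi_neg, neg_sub_neg, norm_sub_rev] using hC r hr) ht

/-- Instead of a Lipschitz bound for `φ_p` along the two flows, a bound which blows up like
`1 / (t - a)` suffices, because `u₁ - u₂` is of size `(t - a) * sup ‖w₁ - w₂‖`. -/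
lemma eq_of_lipschitz (h₁ : IsFlow p q α β (Icc a b) u₁ w₁) (h₂ : IsFlow p q α β (Icc a b) u₂ w₂)
    (hu : u₁ a = u₂ a) (hw : w₁ a = w₂ a) (hab : a ≤ b) {K L : ℝ} (hK : 0 ≤ K) (hL : 0 ≤ L)
    (hsmall : |α| * L * (|β| * K) * (b - a) < 1)
    (hq : ∀ t ∈ Icc a b, ‖phi q (w₁ t) - phi q (w₂ t)‖ ≤ L * ‖w₁ t - w₂ t‖)
    (hp : ∀ t ∈ Icc a b, (t - a) * ‖phi p (u₁ t) - phi p (u₂ t)‖ ≤ K * ‖u₁ t - u₂ t‖) :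
    u₁ b = u₂ b ∧ w₁ b = w₂ b := by
  obtain ⟨m, hm, hmax⟩ := isCompact_Icc.exists_isMaxOn (nonempty_Icc.2 hab)
    (h₁.continuousOn_snd.sub h₂.continuousOn_snd).norm
  set M := ‖w₁ m - w₂ m‖
  have hwM : ∀ t ∈ Icc a b, ‖w₁ t - w₂ t‖ ≤ M := fun t ht => hmax ht
  have hudiff : ∀ t ∈ Icc a b, ‖u₁ t - u₂ t‖ ≤ |α| * (L * M) * (t - a) := fun t ht =>
    h₁.norm_fst_sub_le h₂ hu
      (fun r hr => (hq r hr).trans (mul_le_mul_of_nonneg_left (hwM r hr) hL)) ht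
  have hphi : ∀ t ∈ Icc a b, ‖phi p (u₁ t) - phi p (u₂ t)‖ ≤ K * (|α| * (L * M)) := by
    intro t ht
    rcases ht.1.eq_or_lt with rfl | hlt
    · rw [hu, sub_self, norm_zero]
      positivity
    · refine le_of_mul_le_mul_left ?_ (sub_pos.2 hlt)
      calc (t - a) * ‖phi p (u₁ t) - phi p (u₂ t)‖ ≤ K * ‖u₁ t - u₂ t‖ := hp t ht
        _ ≤ K * (|α| * (L * M) * (t - a)) := mul_le_mul_of_nonneg_left (hudiff t ht) hK
        _ = (t - a) * (K * (|α| * (L * M))) := by ring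
  have hM : M = 0 := by
    by_contra hne
    have hMpos : 0 < M := (norm_nonneg _).lt_of_ne' hne
    have hlt : M < M := calc
      M ≤ |β| * (K * (|α| * (L * M))) * (m - a) := h₁.norm_snd_sub_le h₂ hw hphi hm
      _ ≤ |β| * (K * (|α| * (L * M))) * (b - a) := by gcongr; exact hm.2
      _ = |α| * L * (|β| * K) * (b - a) * M := by ring
      _ < 1 * M := mul_lt_mul_of_pos_right hsmall hMpos
      _ = M := one_mul M
    exact hlt.false
  have hb : b ∈ Icc a b := right_mem_Icc.2 hab
  have hub := hudiff b hb
  rw [hM, mul_zero, mul_zero, zero_mul] at hub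
  exact ⟨sub_eq_zero.1 (norm_le_zero_iff.1 hub), sub_eq_zero.1 (norm_le_zero_iff.1 (hM ▸ hwM b hb))⟩

end IsFlow

/-- The common derivative `v` keeps the two difference quotients in a region where `φ_p` is
Lipschitz, and `φ_p` is homogeneous. -/
lemma exists_eventually_mul_norm_phi_sub_le (hp : 1 < p) {f g : ℝ → E} {v : E}
    (hf : HasDerivWithinAt f v (Ici a) a) (hg : HasDerivWithinAt g v (Ici a) a) (hf0 : f a = 0)
    (hg0 : g a = 0) (hv : v ≠ 0) : ∃ K : ℝ, 0 ≤ K ∧ ∀ᶠ t in 𝓝[>] a,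
      (t - a) * ‖phi p (f t) - phi p (g t)‖ ≤ K * ‖f t - g t‖ := by
  have hslope {h : ℝ → E} (hh : HasDerivWithinAt h v (Ici a) a) (hh0 : h a = 0) :
      Tendsto (fun t => (t - a)⁻¹ • h t) (𝓝[>] a) (𝓝 v) :=
    ((hasDerivWithinAt_iff_tendsto_slope' (lt_irrefl a)).1 (hh.mono Ioi_subset_Ici_self)).congr
      fun t => by simp [slope_def_module, hh0]
  obtain ⟨K, hK, hlip⟩ :=
    exists_eventually_norm_phi_sub_le p hv (hslope hf hf0) (hslope hg hg0)
  refine ⟨K, hK, ?_⟩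
  filter_upwards [hlip, Ioo_mem_nhdsGT (show a < a + 1 by simp)] with t hlip ht
  have hpos : 0 < t - a := sub_pos.2 ht.1
  rw [phi_smul, phi_smul, ← smul_sub, ← smul_sub, norm_smul, norm_smul, norm_phi hp,
    Real.norm_of_nonneg (inv_nonneg.2 hpos.le), Real.inv_rpow hpos.le] at hlip
  have hone : (1 : ℝ) ≤ ((t - a) ^ (p - 1))⁻¹ :=
    (one_le_inv₀ (Real.rpow_pos_of_pos hpos _)).2
      (Real.rpow_le_one hpos.le (by linarith [ht.2]) (by linarith))
  calc (t - a) * ‖phi p (f t) - phi p (g t)‖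
      ≤ (t - a) * (K * ((t - a)⁻¹ * ‖f t - g t‖)) := by
        gcongr
        exact (le_mul_of_one_le_left (norm_nonneg _) hone).trans hlip
    _ = K * ‖f t - g t‖ := by field_simp

namespace IsFlow

lemma hasDerivWithinAt_Ici_fst (h : IsFlow p q α β (Icc a b) u w) (hab : a < b) :
    HasDerivWithinAt u (α • phi q (w a)) (Ici a) a :=
  (h.deriv_fst a (left_mem_Icc.2 hab.le)).mono_of_mem_nhdsWithin (Icc_mem_nhdsGE hab)

lemma tendsto_fst (h : IsFlow p q α β (Icc a b) u w) (hab : a < b) :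
    Tendsto u (𝓝[>] a) (𝓝 (u a)) :=
  (h.hasDerivWithinAt_Ici_fst hab).continuousWithinAt.mono Ioi_subset_Ici_self

lemma exists_lipschitz_fst (h₁ : IsFlow p q α β (Icc a b) u₁ w₁)
    (h₂ : IsFlow p q α β (Icc a b) u₂ w₂) (hab : a < b) (hp : 1 < p) (hα : α ≠ 0)
    (hu : u₁ a = u₂ a) (hw : w₁ a = w₂ a) (hw0 : w₁ a ≠ 0) :
    ∃ K : ℝ, 0 ≤ K ∧ ∀ᶠ t in 𝓝[>] a,
      (t - a) * ‖phi p (u₁ t) - phi p (u₂ t)‖ ≤ K * ‖u₁ t - u₂ t‖ := by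
  rcases eq_or_ne (u₁ a) 0 with hz | hz
  · exact exists_eventually_mul_norm_phi_sub_le hp (h₁.hasDerivWithinAt_Ici_fst hab)
      (hw ▸ h₂.hasDerivWithinAt_Ici_fst hab) hz (hu ▸ hz) (smul_ne_zero hα (phi_eq_zero.not.2 hw0))
  · obtain ⟨K, hK, hlip⟩ := exists_eventually_norm_phi_sub_le p hz (h₁.tendsto_fst hab)
      (hu ▸ h₂.tendsto_fst hab)
    refine ⟨K, hK, ?_⟩
    filter_upwards [hlip, Ioo_mem_nhdsGT (show a < a + 1 by simp)] with t hlip ht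
    exact (mul_le_of_le_one_left (norm_nonneg _) (by linarith [ht.2])).trans hlip

lemma exists_eq_of_snd_ne_zero (h₁ : IsFlow p q α β (Icc a b) u₁ w₁)
    (h₂ : IsFlow p q α β (Icc a b) u₂ w₂) (hab : a < b) (hp : 1 < p) (hα : α ≠ 0)
    (hu : u₁ a = u₂ a) (hw : w₁ a = w₂ a) (hw0 : w₁ a ≠ 0) :
    ∃ c ∈ Ioc a b, u₁ c = u₂ c ∧ w₁ c = w₂ c := by
  obtain ⟨K, hK, hKlip⟩ := h₁.exists_lipschitz_fst h₂ hab hp hα hu hw hw0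
  obtain ⟨L, hL, hLlip⟩ := exists_eventually_norm_phi_sub_le q hw0
    (h₁.swap.tendsto_fst hab) (hw ▸ h₂.swap.tendsto_fst hab)
  obtain ⟨d, had, hd⟩ := mem_nhdsGT_iff_exists_Ioc_subset.1 (hKlip.and hLlip)
  have hshort : ∀ᶠ c in 𝓝[>] a, |α| * L * (|β| * K) * (c - a) < 1 := by
    have hcont : Continuous fun c => |α| * L * (|β| * K) * (c - a) := by fun_prop
    exact (hcont.tendsto' a 0 (by simp)).mono_left nhdsWithin_le_nhds |>.eventually_lt_const one_pos
  obtain ⟨c, hc, hca, hcb⟩ := (hshort.and (Ioo_mem_nhdsGT (lt_min had hab))).exists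
  have hcd : c ≤ d := hcb.le.trans (min_le_left d b)
  have hcb : c ≤ b := hcb.le.trans (min_le_right d b)
  have hsub : Icc a c ⊆ Icc a b := Icc_subset_Icc_right hcb
  refine ⟨c, ⟨hca, hcb⟩, (h₁.mono hsub).eq_of_lipschitz (h₂.mono hsub) hu hw hca.le hK hL hc
    (fun t ht => ?_) fun t ht => ?_⟩ <;> rcases ht.1.eq_or_lt with rfl | hlt
  · simp [hw]
  · exact (hd ⟨hlt, ht.2.trans hcd⟩).2
  · simp [hu]
  · exact (hd ⟨hlt, ht.2.trans hcd⟩).1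

lemma exists_eq_of_ne_zero (h₁ : IsFlow p q α β (Icc a b) u₁ w₁)
    (h₂ : IsFlow p q α β (Icc a b) u₂ w₂) (hab : a < b) (hp : 1 < p) (hq : 1 < q) (hα : α ≠ 0)
    (hβ : β ≠ 0) (hu : u₁ a = u₂ a) (hw : w₁ a = w₂ a) (h0 : ¬(u₁ a = 0 ∧ w₁ a = 0)) :
    ∃ c ∈ Ioc a b, u₁ c = u₂ c ∧ w₁ c = w₂ c := by
  by_cases hw0 : w₁ a = 0
  · have hu0 : u₁ a ≠ 0 := fun hu0 => h0 ⟨hu0, hw0⟩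
    obtain ⟨c, hc, hwc, huc⟩ := h₁.swap.exists_eq_of_snd_ne_zero h₂.swap hab hq hβ hw
      (congrArg Neg.neg hu) (neg_ne_zero.2 hu0)
    exact ⟨c, hc, neg_injective huc, hwc⟩
  · exact h₁.exists_eq_of_snd_ne_zero h₂ hab hp hα hu hw hw0

theorem unique (h₁ : IsFlow p q α β (Icc a b) u₁ w₁) (h₂ : IsFlow p q α β (Icc a b) u₂ w₂)
    (hp : 1 < p) (hq : 1 < q) (hα : 0 < α) (hβ : 0 < β) (hu : u₁ a = u₂ a) (hw : w₁ a = w₂ a)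
    {t : ℝ} (ht : t ∈ Icc a b) : u₁ t = u₂ t ∧ w₁ t = w₂ t := by
  have ha : a ∈ Icc a b := left_mem_Icc.2 (ht.1.trans ht.2)
  have hconvex : Convex ℝ (Icc a b) := convex_Icc a b
  by_cases hz : u₁ a = 0 ∧ w₁ a = 0
  · obtain ⟨hu₁, hw₁⟩ := h₁.eq_zero_of_eq_zero hp hq hα hβ hconvex ha hz.1 hz.2 ht
    obtain ⟨hu₂, hw₂⟩ :=
      h₂.eq_zero_of_eq_zero hp hq hα hβ hconvex ha (hu ▸ hz.1) (hw ▸ hz.2) ht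
    exact ⟨hu₁.trans hu₂.symm, hw₁.trans hw₂.symm⟩
  have hclosed : IsClosed ({t | u₁ t = u₂ t ∧ w₁ t = w₂ t} ∩ Icc a b) := by
    have hcont := (h₁.continuousOn_fst.prodMk h₁.continuousOn_snd).sub
      (h₂.continuousOn_fst.prodMk h₂.continuousOn_snd)
    convert hcont.preimage_isClosed_of_isClosed isClosed_Icc (isClosed_singleton (x := 0)) using 1
    ext t
    simp [sub_eq_zero, and_comm]
  refine hclosed.Icc_subset_of_forall_exists_gt ⟨hu, hw⟩ ?_ ht
  rintro x ⟨⟨hxu, hxw⟩, hx⟩ y hxy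
  have hsub : Icc x (min y b) ⊆ Icc a b := Icc_subset_Icc hx.1 (min_le_right y b)
  obtain ⟨c, hc, heq⟩ := (h₁.mono hsub).exists_eq_of_ne_zero (h₂.mono hsub) (lt_min hxy hx.2) hp hq
    hα.ne' hβ.ne' hxu hxw fun h0 => hz (h₁.eq_zero_of_eq_zero hp hq hα hβ hconvex
      (Ico_subset_Icc_self hx) h0.1 h0.2 ha)
  exact ⟨c, heq, hc.1, hc.2.trans (min_le_left y b)⟩

lemma fst_eq_fst_of_univ (h₁ : IsFlow p q α β univ u₁ w₁) (h₂ : IsFlow p q α β univ u₂ w₂)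
    (hp : 1 < p) (hq : 1 < q) (hα : 0 < α) (hβ : 0 < β) (hu : u₁ 0 = u₂ 0) (hw : w₁ 0 = w₂ 0) :
    u₁ = u₂ := by
  ext t
  rcases le_total 0 t with ht | ht
  · exact ((h₁.mono (subset_univ _)).unique (h₂.mono (subset_univ _)) hp hq hα hβ hu hw
      (right_mem_Icc.2 ht)).1
  · have heq := ((h₁.reflect.mono (subset_univ _)).unique (h₂.reflect.mono (subset_univ _))
      hp hq hα hβ (by simp [hu]) (by simp [hw]) (right_mem_Icc.2 (neg_nonneg.2 ht))).1
    simpa using heq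

end IsFlow

end Flow

/-! ### Generalized trigonometric functions -/

section GeneralizedSine

open Real ProbabilityTheory

lemma hasDerivAt_phi_real (a : ℝ) {x : ℝ} (hx : x ≠ 0) :
    HasDerivAt (phi a) ((a - 1) * |x| ^ (a - 2)) x := by
  have hpos : ∀ y : ℝ, 0 < y → HasDerivAt (phi a) ((a - 1) * |y| ^ (a - 2)) y := by
    intro y hy
    rw [abs_of_pos hy, show a - 2 = a - 1 - 1 by ring]
    refine (hasDerivAt_rpow_const (p := a - 1) (Or.inl hy.ne')).congr_of_eventuallyEq ?_
    filter_upwards [lt_mem_nhds hy] with z hz using phi_of_pos a hz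
  rcases hx.lt_or_gt with h | h
  · have hneg := (HasDerivAt.scomp x (hpos (-x) (neg_pos.2 h)) (hasDerivAt_neg x)).fun_neg
    simpa [Function.comp_def, phi_neg] using hneg
  · exact hpos x h

lemma countable_sin_mul_cos_eq_zero : {θ : ℝ | sin θ * cos θ = 0}.Countable := by
  refine (countable_range fun n : ℤ => n * π / 2).mono fun θ (hθ : sin θ * cos θ = 0) => ?_
  have hsin : sin (2 * θ) = 0 := by rw [sin_two_mul, mul_assoc, hθ, mul_zero]
  obtain ⟨n, hn⟩ := sin_eq_zero_iff.1 hsin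
  exact ⟨n, by linarith⟩

lemma sin_pos_and_cos_pos {θ : ℝ} (hθ : θ ∈ Ioo 0 (π / 2)) : 0 < sin θ ∧ 0 < cos θ :=
  ⟨sin_pos_of_pos_of_lt_pi hθ.1 (by linarith [hθ.2, pi_pos]),
    cos_pos_of_mem_Ioo ⟨by linarith [hθ.1, pi_pos], hθ.2⟩⟩

lemma bijOn_sin_sq : BijOn (fun θ => sin θ ^ 2) (Ioo 0 (π / 2)) (Ioo 0 1) := by
  refine ⟨fun θ hθ => ?_, fun x hx y hy hxy => ?_, fun x hx => ?_⟩
  · obtain ⟨hs, hc⟩ := sin_pos_and_cos_pos hθ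
    exact ⟨pow_pos hs 2, by nlinarith [sin_sq_add_cos_sq θ]⟩
  · have hsin : sin x = sin y := (sq_eq_sq₀ (sin_pos_and_cos_pos hx).1.le
      (sin_pos_and_cos_pos hy).1.le).1 hxy
    exact injOn_sin ⟨by linarith [hx.1, pi_pos], hx.2.le⟩ ⟨by linarith [hy.1, pi_pos], hy.2.le⟩ hsin
  · have hsqrt : 0 < √x := sqrt_pos.2 hx.1
    have hsqrt' : √x < 1 := by simpa using sqrt_lt_sqrt hx.1.le hx.2
    refine ⟨arcsin √x, ⟨arcsin_pos.2 hsqrt, arcsin_lt_pi_div_two.2 hsqrt'⟩, ?_⟩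
    simp only [sin_arcsin (by linarith) hsqrt'.le, sq_sqrt hx.1.le]

lemma betaPDFReal_nonneg {a b : ℝ} (ha : 0 < a) (hb : 0 < b) (x : ℝ) : 0 ≤ betaPDFReal a b x := by
  by_cases hx : 0 < x ∧ x < 1
  · exact (betaPDFReal_pos hx.1 hx.2 ha hb).le
  · rw [betaPDFReal, if_neg hx]

lemma integrable_betaPDFReal {a b : ℝ} (ha : 0 < a) (hb : 0 < b) :
    Integrable (betaPDFReal a b) := by
  rw [← lintegral_ofReal_ne_top_iff_integrable (by fun_prop)
    (ae_of_all _ (betaPDFReal_nonneg ha hb))]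
  exact (lintegral_betaPDF_eq_one ha hb).trans_ne ENNReal.one_ne_top

lemma integral_betaPDFReal {a b : ℝ} (ha : 0 < a) (hb : 0 < b) :
    ∫ x in Ioo 0 1, betaPDFReal a b x = 1 := by
  have hzero : ∀ x ∉ Ioo 0 1, betaPDFReal a b x = 0 := fun x hx => if_neg hx
  rw [setIntegral_eq_integral_of_forall_compl_eq_zero hzero,
    integral_eq_lintegral_of_nonneg_ae (ae_of_all _ (betaPDFReal_nonneg ha hb)) (by fun_prop)]
  exact congrArg ENNReal.toReal (lintegral_betaPDF_eq_one ha hb)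

variable {p q : ℝ}

lemma beta_inv_of_holderConjugate (hpq : p.HolderConjugate q) :
    beta p⁻¹ q⁻¹ = π / sin (π / p) := by
  rw [beta, ← hpq.one_sub_inv, Gamma_mul_Gamma_one_sub, add_sub_cancel, Gamma_one, div_one,
    div_eq_mul_inv π p]

/-- Up to the factor `2 (p - 1)^(1/p) / p`, this is `dt/dθ` along the parametrization
`((p - 1)^(1/p) |sin θ|^(2/p-1) sin θ, |cos θ|^(2/q-1) cos θ)` of the energy level of the scalar
system that passes through `(0, 1)`. -/
noncomputable def angularDensity (p q θ : ℝ) : ℝ := |sin θ| ^ (2 / p - 1) * |cos θ| ^ (2 / q - 1)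

lemma measurable_angularDensity (p q : ℝ) : Measurable (angularDensity p q) := by
  unfold angularDensity
  fun_prop

lemma angularDensity_nonneg (p q θ : ℝ) : 0 ≤ angularDensity p q θ := by
  unfold angularDensity
  positivity

lemma angularDensity_pos {θ : ℝ} (h : sin θ * cos θ ≠ 0) : 0 < angularDensity p q θ :=
  mul_pos (rpow_pos_of_pos (abs_pos.2 (left_ne_zero_of_mul h)) _)
    (rpow_pos_of_pos (abs_pos.2 (right_ne_zero_of_mul h)) _)

lemma continuousAt_angularDensity {θ : ℝ} (h : sin θ * cos θ ≠ 0) :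
    ContinuousAt (angularDensity p q) θ :=
  (continuous_sin.abs.continuousAt.rpow_const
    (Or.inl (abs_pos.2 (left_ne_zero_of_mul h)).ne')).mul
    (continuous_cos.abs.continuousAt.rpow_const
      (Or.inl (abs_pos.2 (right_ne_zero_of_mul h)).ne'))

lemma periodic_angularDensity (p q : ℝ) : Function.Periodic (angularDensity p q) π := by
  intro θ
  simp [angularDensity, sin_add_pi, cos_add_pi]

lemma angularDensity_pi_sub (p q θ : ℝ) : angularDensity p q (π - θ) = angularDensity p q θ := by
  simp [angularDensity, sin_pi_sub, cos_pi_sub]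

lemma sq_rpow_inv_sub_one {x : ℝ} (hx : 0 < x) (r : ℝ) :
    (x ^ 2) ^ (r⁻¹ - 1) = x ^ (2 / r - 1) * x⁻¹ := by
  rw [← rpow_natCast, ← rpow_mul hx.le, ← rpow_neg_one x, ← rpow_add hx]
  congr 1
  push_cast
  ring

lemma abs_mul_betaPDFReal_sin_sq {θ : ℝ} (hθ : θ ∈ Ioo 0 (π / 2)) :
    |2 * sin θ * cos θ| • betaPDFReal p⁻¹ q⁻¹ (sin θ ^ 2) =
      2 / beta p⁻¹ q⁻¹ * angularDensity p q θ := by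
  obtain ⟨hs, hc⟩ := sin_pos_and_cos_pos hθ
  have hcos : 1 - sin θ ^ 2 = cos θ ^ 2 := by linarith [sin_sq_add_cos_sq θ]
  have hmem : 0 < sin θ ^ 2 ∧ sin θ ^ 2 < 1 := bijOn_sin_sq.mapsTo hθ
  rw [betaPDFReal, if_pos hmem, hcos, sq_rpow_inv_sub_one hs,
    sq_rpow_inv_sub_one hc, angularDensity, abs_of_pos hs, abs_of_pos hc,
    abs_of_pos (by positivity), smul_eq_mul]
  field_simp

lemma integrableOn_angularDensity (hp : 0 < p) (hq : 0 < q) :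
    IntegrableOn (angularDensity p q) (Ioo 0 (π / 2)) := by
  have hbeta := beta_pos (inv_pos.2 hp) (inv_pos.2 hq)
  have hsubst := (integrableOn_image_iff_integrableOn_abs_deriv_smul measurableSet_Ioo
    (fun θ _ => ((hasDerivAt_sin θ).fun_pow 2).hasDerivWithinAt) bijOn_sin_sq.injOn
    (betaPDFReal p⁻¹ q⁻¹)).1 (integrable_betaPDFReal (inv_pos.2 hp) (inv_pos.2 hq)).integrableOn
  simp only [Nat.cast_ofNat, Nat.add_one_sub_one, pow_one] at hsubst
  rw [integrableOn_congr_fun (fun θ hθ => abs_mul_betaPDFReal_sin_sq hθ) measurableSet_Ioo]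
    at hsubst
  exact (integrable_const_mul_iff (by simpa using hbeta.ne') _).1 hsubst

lemma setIntegral_angularDensity (hp : 0 < p) (hq : 0 < q) :
    ∫ θ in Ioo 0 (π / 2), angularDensity p q θ = beta p⁻¹ q⁻¹ / 2 := by
  have hbeta := beta_pos (inv_pos.2 hp) (inv_pos.2 hq)
  have hsubst := integral_image_eq_integral_abs_deriv_smul measurableSet_Ioo
    (fun θ _ => ((hasDerivAt_sin θ).fun_pow 2).hasDerivWithinAt) bijOn_sin_sq.injOn
    (betaPDFReal p⁻¹ q⁻¹)
  simp only [Nat.cast_ofNat, Nat.add_one_sub_one, pow_one] at hsubst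
  rw [bijOn_sin_sq.image_eq, integral_betaPDFReal (inv_pos.2 hp) (inv_pos.2 hq),
    setIntegral_congr_fun measurableSet_Ioo fun θ hθ => abs_mul_betaPDFReal_sin_sq hθ,
    integral_const_mul] at hsubst
  linear_combination beta p⁻¹ q⁻¹ / 2 * hsubst.symm -
    (∫ θ in Ioo 0 (π / 2), angularDensity p q θ) * mul_inv_cancel₀ hbeta.ne'

lemma intervalIntegrable_angularDensity (hp : 0 < p) (hq : 0 < q) (a b : ℝ) :
    IntervalIntegrable (angularDensity p q) volume a b := by
  have hquarter : IntervalIntegrable (angularDensity p q) volume 0 (π / 2) :=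
    (intervalIntegrable_iff_integrableOn_Ioo_of_le (by positivity)).2
      (integrableOn_angularDensity hp hq)
  have hreflect := hquarter.comp_sub_left π
  simp only [angularDensity_pi_sub, sub_zero, sub_half] at hreflect
  exact (periodic_angularDensity p q).intervalIntegrable₀ pi_ne_zero
    (hquarter.trans hreflect.symm) a b

lemma integral_angularDensity (hp : 0 < p) (hq : 0 < q) :
    ∫ θ in (0 : ℝ)..π, angularDensity p q θ = beta p⁻¹ q⁻¹ := by
  have hint := intervalIntegrable_angularDensity hp hq
  have hquarter : ∫ θ in (0 : ℝ)..π / 2, angularDensity p q θ = beta p⁻¹ q⁻¹ / 2 := by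
    rw [intervalIntegral.integral_of_le (by positivity), integral_Ioc_eq_integral_Ioo,
      setIntegral_angularDensity hp hq]
  have hreflect := intervalIntegral.integral_comp_sub_left (a := 0) (b := π / 2)
    (angularDensity p q) π
  simp only [angularDensity_pi_sub, sub_zero, sub_half] at hreflect
  rw [← intervalIntegral.integral_add_adjacent_intervals (hint 0 (π / 2)) (hint (π / 2) π),
    ← hreflect, hquarter, add_halves]

lemma integral_angularDensity_pos (hp : 0 < p) (hq : 0 < q) {a b : ℝ} (hab : a < b) :
    0 < ∫ θ in a..b, angularDensity p q θ := by
  rw [intervalIntegral.integral_pos_iff_support_of_nonneg_ae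
    (ae_of_all _ (angularDensity_nonneg p q)) (intervalIntegrable_angularDensity hp hq a b)]
  have hsub : Ioc a b \ {θ : ℝ | sin θ * cos θ = 0} ⊆
      Function.support (angularDensity p q) ∩ Ioc a b :=
    fun θ hθ => ⟨(angularDensity_pos hθ.2).ne', hθ.1⟩
  refine ⟨hab, lt_of_lt_of_le ?_ (measure_mono hsub)⟩
  rw [measure_sdiff_null (countable_sin_mul_cos_eq_zero.measure_zero volume)]
  simpa using hab

/-- The maximum `(p - 1)^(1/p)` of the solution of the scalar problem. -/
noncomputable def amplitude (p : ℝ) : ℝ := (p - 1) ^ p⁻¹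

lemma amplitude_pos (hp : 1 < p) : 0 < amplitude p := rpow_pos_of_pos (sub_pos.2 hp) _

lemma amplitude_rpow (hp : 1 < p) : amplitude p ^ p = p - 1 :=
  rpow_inv_rpow (sub_pos.2 hp).le (by positivity)

/-- The time at which the solution of the scalar problem has gone through the angle `θ`. -/
noncomputable def elapsedTime (p q θ : ℝ) : ℝ :=
  2 * amplitude p / p * ∫ x in (0 : ℝ)..θ, angularDensity p q x

lemma elapsedTime_zero (p q : ℝ) : elapsedTime p q 0 = 0 := by simp [elapsedTime]

lemma strictMono_elapsedTime (hp : 1 < p) (hq : 0 < q) : StrictMono (elapsedTime p q) := by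
  intro a b hab
  have hp0 : 0 < p := by positivity
  have hpos := integral_angularDensity_pos hp0 hq hab
  have hint := intervalIntegrable_angularDensity hp0 hq
  have hamp := amplitude_pos hp
  rw [← intervalIntegral.integral_interval_sub_left (hint 0 b) (hint 0 a), sub_pos] at hpos
  exact mul_lt_mul_of_pos_left hpos (by positivity)

lemma surjective_elapsedTime (hp : 1 < p) (hq : 0 < q) :
    Function.Surjective (elapsedTime p q) := by
  have hp0 : 0 < p := by positivity
  have hpos := integral_angularDensity_pos hp0 hq pi_pos
  have hper := periodic_angularDensity p q
  have hamp := amplitude_pos hp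
  have hscale : 0 < 2 * amplitude p / p := by positivity
  exact ((intervalIntegral.continuous_primitive
    (intervalIntegrable_angularDensity hp0 hq) 0).const_mul _).surjective
    ((hper.tendsto_atTop_intervalIntegral_of_pos hpos pi_pos).const_mul_atTop hscale)
    ((hper.tendsto_atBot_intervalIntegral_of_pos hpos pi_pos).const_mul_atBot hscale)

lemma hasDerivAt_elapsedTime (hp : 0 < p) (hq : 0 < q) {θ : ℝ} (hθ : sin θ * cos θ ≠ 0) :
    HasDerivAt (elapsedTime p q) (2 * amplitude p / p * angularDensity p q θ) θ :=
  (intervalIntegral.integral_hasDerivAt_right (intervalIntegrable_angularDensity hp hq 0 θ)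
    (measurable_angularDensity p q).stronglyMeasurable.stronglyMeasurableAtFilter
    (continuousAt_angularDensity hθ)).const_mul _

/-- Half of the period of the solution of the scalar problem, which is `elapsedTime p q π`. -/
noncomputable def halfPeriod (p : ℝ) : ℝ := 2 * amplitude p / p * (π / sin (π / p))

lemma sin_pi_div_pos (hp : 1 < p) : 0 < sin (π / p) :=
  sin_pos_of_pos_of_lt_pi (by positivity) (div_lt_self pi_pos hp)

lemma halfPeriod_pos (hp : 1 < p) : 0 < halfPeriod p := by
  have hamp := amplitude_pos hp
  have hsin := sin_pi_div_pos hp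
  unfold halfPeriod
  positivity

lemma halfPeriod_rpow (hp : 1 < p) : halfPeriod p ^ p = lam p := by
  have hamp := amplitude_pos hp
  have hsin := sin_pi_div_pos hp
  have hfactor : halfPeriod p = 2 * π * amplitude p / (p * sin (π / p)) := by
    rw [halfPeriod]
    field_simp
  rw [hfactor, div_rpow (by positivity) (by positivity), mul_rpow (by positivity) hamp.le,
    amplitude_rpow hp, lam]

lemma elapsedTime_int_mul_pi (hpq : p.HolderConjugate q) (k : ℤ) :
    elapsedTime p q (k * π) = k * halfPeriod p := by
  have hperiods := (periodic_angularDensity p q).intervalIntegral_add_zsmul_eq k 0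
    (intervalIntegrable_angularDensity hpq.pos hpq.symm.pos)
  rw [zero_add, zero_add, integral_angularDensity hpq.pos hpq.symm.pos,
    beta_inv_of_holderConjugate hpq, zsmul_eq_mul, zsmul_eq_mul] at hperiods
  rw [elapsedTime, hperiods, halfPeriod]
  ring

/-- The angle as a function of time. -/
noncomputable def angle (hpq : p.HolderConjugate q) : ℝ ≃o ℝ :=
  ((strictMono_elapsedTime hpq.lt hpq.symm.pos).orderIsoOfSurjective _
    (surjective_elapsedTime hpq.lt hpq.symm.pos)).symm

lemma elapsedTime_angle (hpq : p.HolderConjugate q) (t : ℝ) : elapsedTime p q (angle hpq t) = t :=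
  (angle hpq).symm_apply_apply t

lemma angle_elapsedTime (hpq : p.HolderConjugate q) (θ : ℝ) : angle hpq (elapsedTime p q θ) = θ :=
  (angle hpq).apply_symm_apply θ

lemma angle_zero (hpq : p.HolderConjugate q) : angle hpq 0 = 0 := by
  simpa only [elapsedTime_zero] using angle_elapsedTime hpq 0

lemma hasDerivAt_angle (hpq : p.HolderConjugate q) {t : ℝ}
    (ht : sin (angle hpq t) * cos (angle hpq t) ≠ 0) :
    HasDerivAt (angle hpq) (2 * amplitude p / p * angularDensity p q (angle hpq t))⁻¹ t := by
  have hdensity := angularDensity_pos (p := p) (q := q) ht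
  have hamp := amplitude_pos hpq.lt
  have hp := hpq.pos
  exact (hasDerivAt_elapsedTime hp hpq.symm.pos ht).of_local_left_inverse
    (angle hpq).continuous.continuousAt (by positivity) (.of_forall (elapsedTime_angle hpq))

/-- The solution of the scalar problem: a generalized sine function. -/
noncomputable def pSin (hpq : p.HolderConjugate q) (t : ℝ) : ℝ :=
  amplitude p * phi (2 / p + 1) (sin (angle hpq t))

/-- The generalized cosine `φ_p(u')`, where `u` is the generalized sine `pSin`. -/
noncomputable def pCos (hpq : p.HolderConjugate q) (t : ℝ) : ℝ :=
  phi (2 / q + 1) (cos (angle hpq t))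

lemma pSin_zero (hpq : p.HolderConjugate q) : pSin hpq 0 = 0 := by simp [pSin, angle_zero]

lemma pCos_zero (hpq : p.HolderConjugate q) : pCos hpq 0 = 1 := by
  simp [pCos, angle_zero, phi_one_real]

lemma pSin_eq_zero_iff (hpq : p.HolderConjugate q) {t : ℝ} :
    pSin hpq t = 0 ↔ ∃ k : ℤ, k * halfPeriod p = t := by
  rw [pSin, mul_eq_zero_iff_left (amplitude_pos hpq.lt).ne', phi_eq_zero, sin_eq_zero_iff]
  refine exists_congr fun k => ?_
  rw [← elapsedTime_int_mul_pi hpq]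
  exact ⟨fun h => h ▸ elapsedTime_angle hpq t, fun h => h ▸ (angle_elapsedTime hpq _).symm⟩

lemma continuous_pSin (hpq : p.HolderConjugate q) : Continuous (pSin hpq) :=
  ((continuous_phi (by simpa using hpq.pos)).comp
    (continuous_sin.comp (angle hpq).continuous)).const_mul _

lemma continuous_pCos (hpq : p.HolderConjugate q) : Continuous (pCos hpq) :=
  (continuous_phi (by simpa using hpq.symm.pos)).comp (continuous_cos.comp (angle hpq).continuous)

lemma hasDerivAt_pSin_of_ne_zero (hpq : p.HolderConjugate q) {t : ℝ}
    (ht : sin (angle hpq t) * cos (angle hpq t) ≠ 0) :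
    HasDerivAt (pSin hpq) (phi q (pCos hpq t)) t := by
  have hsin := left_ne_zero_of_mul ht
  have hcos := right_ne_zero_of_mul ht
  have hchain := ((hasDerivAt_phi_real (2 / p + 1) hsin).comp t
    (hasDerivAt_angle hpq ht).sin).const_mul (amplitude p)
  convert! hchain using 1
  have hexp : (q - 1) * (2 / q + 1 - 1) + 1 - 2 = -(2 / q - 1) := by
    have := hpq.symm.ne_zero
    field_simp
    ring
  have hp := hpq.ne_zero
  have hamp := (amplitude_pos hpq.lt).ne'
  have hc := (rpow_pos_of_pos (abs_pos.2 hcos) (2 / q - 1)).ne'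
  rw [pCos, phi_phi, phi, angularDensity, hexp, norm_eq_abs, rpow_neg (abs_nonneg _), smul_eq_mul,
    show 2 / p + 1 - 2 = 2 / p - 1 by ring]
  field_simp
  ring

lemma hasDerivAt_pCos_of_ne_zero (hpq : p.HolderConjugate q) {t : ℝ}
    (ht : sin (angle hpq t) * cos (angle hpq t) ≠ 0) :
    HasDerivAt (pCos hpq) (-phi p (pSin hpq t)) t := by
  have hsin := left_ne_zero_of_mul ht
  have hcos := right_ne_zero_of_mul ht
  have hchain := (hasDerivAt_phi_real (2 / q + 1) hcos).comp t (hasDerivAt_angle hpq ht).cos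
  convert! hchain using 1
  have hp := hpq.ne_zero
  have hq := hpq.symm.ne_zero
  have hamp := amplitude_pos hpq.lt
  have hexp : (p - 1) * (2 / p + 1 - 1) + 1 - 2 = -(2 / p - 1) := by
    field_simp
    ring
  have hamp' : phi p (amplitude p) = p / (q * amplitude p) := by
    rw [phi_of_pos p hamp, rpow_sub_one hamp.ne', amplitude_rpow hpq.lt,
      div_eq_div_iff hamp.ne' (by positivity)]
    linear_combination amplitude p * hpq.sub_one_mul_conj
  rw [pSin, ← smul_eq_mul, phi_smul, hamp', phi_phi, phi, angularDensity, hexp, norm_eq_abs,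
    rpow_neg (abs_nonneg _), show 2 / q + 1 - 2 = 2 / q - 1 by ring]
  simp only [smul_eq_mul]
  field_simp
  ring

lemma hasDerivAt_of_off_countable {F : Type*} [NormedAddCommGroup F] [NormedSpace ℝ F]
    [CompleteSpace F] {f g : ℝ → F} {s : Set ℝ} (hs : s.Countable) (hf : Continuous f)
    (hg : Continuous g) (h : ∀ x ∉ s, HasDerivAt f (g x) x) (x : ℝ) : HasDerivAt f (g x) x := by
  have hftc : f = fun t => f 0 + ∫ y in (0 : ℝ)..t, g y := by
    ext t
    rw [integral_eq_of_hasDerivAt_off_countable f g hs hf.continuousOn (fun y hy => h y hy.2)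
      (hg.intervalIntegrable _ _), add_sub_cancel]
  rw [hftc]
  exact (hg.integral_hasStrictDerivAt 0 x).hasDerivAt.const_add _

theorem isFlow_pSin_pCos (hpq : p.HolderConjugate q) :
    IsFlow p q 1 1 univ (pSin hpq) (pCos hpq) := by
  have hcountable : (angle hpq ⁻¹' {θ | sin θ * cos θ = 0}).Countable :=
    countable_sin_mul_cos_eq_zero.preimage (angle hpq).injective
  have hpSin := hasDerivAt_of_off_countable hcountable (continuous_pSin hpq)
    ((continuous_phi hpq.symm.lt).comp (continuous_pCos hpq))
    fun t ht => hasDerivAt_pSin_of_ne_zero hpq ht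
  have hpCos := hasDerivAt_of_off_countable hcountable (continuous_pCos hpq)
    ((continuous_phi hpq.lt).comp (continuous_pSin hpq)).neg
    fun t ht => hasDerivAt_pCos_of_ne_zero hpq ht
  exact ⟨fun t _ => by simpa using hpSin t, fun t _ => by simpa using hpCos t⟩

end GeneralizedSine

section Identification

variable {p q β : ℝ} {u w : ℝ → E} {ω : ℝ → ℝ}

namespace IsFlow

lemma hasDerivAt_fst (h : IsFlow p q 1 β univ u w) (t : ℝ) : HasDerivAt u (phi q (w t)) t := by
  simpa using h.deriv_fst t trivial

lemma hasDerivAt_snd (h : IsFlow p q 1 β univ u w) (t : ℝ) :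
    HasDerivAt w (-(β • phi p (u t))) t := by
  simpa using h.deriv_snd t trivial

lemma phi_deriv_fst (h : IsFlow p q 1 β univ u w) (hpq : p.HolderConjugate q) :
    (fun t => phi p (deriv u t)) = w := by
  ext t
  rw [(h.hasDerivAt_fst t).deriv, phi_phi_of_holderConjugate hpq]

lemma isOmega {w : ℝ → ℝ} (h : IsFlow p q 1 1 univ ω w) (hpq : p.HolderConjugate q)
    (hω : ω 0 = 0) (hw : w 0 = 1) : IsOmega p ω where
  differentiable t := (h.hasDerivAt_fst t).differentiableAt
  ode t := by simpa only [h.phi_deriv_fst hpq, one_smul] using h.hasDerivAt_snd t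
  zero := hω
  deriv_zero := by rw [(h.hasDerivAt_fst 0).deriv, hw, phi_one_real]

lemma isClassicalSolution (h : IsFlow p q 1 β univ u w) (hpq : p.HolderConjugate q)
    (h0 : u 0 = 0) (h1 : u 1 = 0) : IsClassicalSolution p β u where
  continuousOn := (h.mono (subset_univ _)).continuousOn_fst
  differentiableAt t _ := (h.hasDerivAt_fst t).differentiableAt
  ode t _ := by simpa only [h.phi_deriv_fst hpq] using h.hasDerivAt_snd t
  left := h0
  right := h1

lemma rescale {w : ℝ → ℝ} (h : IsFlow p q 1 1 univ ω w) (hpq : p.HolderConjugate q) {μ : ℝ}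
    (hμ : 0 < μ) (c : E) : IsFlow p q 1 (μ ^ p) univ
      (fun t => ω (μ * t) • (μ⁻¹ • c)) (fun t => w (μ * t) • phi p c) where
  deriv_fst t _ := by
    have hscale := (HasDerivAt.scomp t (h.hasDerivAt_fst (μ * t))
      (hasDerivAt_const_mul μ)).smul_const (μ⁻¹ • c)
    refine HasDerivAt.hasDerivWithinAt ?_
    convert! hscale using 1
    rw [one_smul, phi_smul, phi_phi_of_holderConjugate hpq.symm, smul_smul, smul_eq_mul,
      mul_right_comm, mul_inv_cancel₀ hμ.ne', one_mul]
  deriv_snd t _ := by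
    have hscale := (HasDerivAt.scomp t (h.hasDerivAt_snd (μ * t))
      (hasDerivAt_const_mul μ)).smul_const (phi p c)
    refine HasDerivAt.hasDerivWithinAt ?_
    convert! hscale using 1
    rw [phi_smul, phi_smul, phi_of_pos p (inv_pos.2 hμ), Real.inv_rpow hμ.le,
      Real.rpow_sub_one hμ.ne']
    have hpow := (Real.rpow_pos_of_pos hμ p).ne'
    simp only [smul_smul, smul_eq_mul, ← neg_smul]
    field_simp

end IsFlow

lemma IsOmega.isFlow (h : IsOmega p ω) (hpq : p.HolderConjugate q) :
    IsFlow p q 1 1 univ ω (fun t => phi p (deriv ω t)) where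
  deriv_fst t _ := by
    simpa [phi_phi_of_holderConjugate hpq.symm] using (h.differentiable t).hasDerivAt
  deriv_snd t _ := by simpa using h.ode t

lemma IsOmega.eq_pSin (h : IsOmega p ω) (hpq : p.HolderConjugate q) : ω = pSin hpq :=
  (h.isFlow hpq).fst_eq_fst_of_univ (isFlow_pSin_pCos hpq) hpq.lt hpq.symm.lt one_pos one_pos
    (by rw [h.zero, pSin_zero]) (by rw [h.deriv_zero, phi_one_real, pCos_zero])

theorem existsUnique_isOmega (hpq : p.HolderConjugate q) : ∃! ω : ℝ → ℝ, IsOmega p ω :=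
  ⟨pSin hpq, (isFlow_pSin_pCos hpq).isOmega hpq (pSin_zero hpq) (pCos_zero hpq),
    fun _ hω => hω.eq_pSin hpq⟩

lemma IsOmega.exists_rpow_eq (hω : IsOmega p ω) (hpq : p.HolderConjugate q) {t : ℝ} (ht : 0 < t)
    (h : ω t = 0) : ∃ k : ℕ, 0 < k ∧ t ^ p = (k : ℝ) ^ p * lam p := by
  rw [hω.eq_pSin hpq, pSin_eq_zero_iff] at h
  obtain ⟨k, rfl⟩ := h
  have hperiod := halfPeriod_pos hpq.lt
  have hk : 0 < k := by exact_mod_cast pos_of_mul_pos_left ht hperiod.le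
  lift k to ℕ using hk.le
  refine ⟨k, by exact_mod_cast hk, ?_⟩
  rw [Int.cast_natCast, Real.mul_rpow k.cast_nonneg hperiod.le, halfPeriod_rpow hpq.lt]

lemma IsFlow.exists_eq_smul_omega {b μ : ℝ} (h : IsFlow p q 1 (μ ^ p) (Icc 0 b) u w)
    (hω : IsOmega p ω) (hpq : p.HolderConjugate q) (hμ : 0 < μ) (h0 : u 0 = 0) :
    ∃ c : E, ∀ t ∈ Icc 0 b, u t = ω (μ * t) • (μ⁻¹ • c) :=
  ⟨phi q (w 0), fun _ ht =>
    (h.unique (((hω.isFlow hpq).rescale hpq hμ (phi q (w 0))).mono (subset_univ _)) hpq.lt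
      hpq.symm.lt one_pos (Real.rpow_pos_of_pos hμ p) (by simp [h0, hω.zero])
      (by simp [hω.deriv_zero, phi_one_real, phi_phi_of_holderConjugate hpq]) ht).1⟩

lemma isFlow_of_eq_integral [CompleteSpace E] {a b : ℝ} (hq : 1 < q) (hw : Continuous w)
    (hderiv : ∀ t ∈ Icc a b, HasDerivAt w (-(β • phi p (u t))) t)
    (hu : ∀ t ∈ Icc a b, u t = u a + ∫ s in a..t, phi q (w s)) :
    IsFlow p q 1 β (Icc a b) u w where
  deriv_fst t ht := by
    have hftc := (((continuous_phi hq).comp hw).integral_hasStrictDerivAt a t).hasDerivAt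
    rw [one_smul]
    exact (hftc.const_add (u a)).hasDerivWithinAt.congr hu (hu t ht)
  deriv_snd t ht := (hderiv t ht).hasDerivWithinAt

lemma IsClassicalSolution.exists_isFlow [CompleteSpace E] (h : IsClassicalSolution p β u)
    (hpq : p.HolderConjugate q) : ∃ w : ℝ → E, IsFlow p q 1 β (Icc 0 1) u w := by
  let v : ℝ → E := IccExtend zero_le_one ((Icc 0 1).domRestrict u)
  have hv : Continuous v := (continuousOn_iff_continuous_domRestrict.1 h.continuousOn).Icc_extend'
  have hvu : ∀ t ∈ Icc (0 : ℝ) 1, v t = u t := fun t ht => IccExtend_of_mem _ _ ht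
  have hphi : Continuous fun t => -(β • phi p (v t)) :=
    (((continuous_phi hpq.lt).comp hv).const_smul β).neg
  let w : ℝ → E := fun t => phi p (deriv u (1 / 2)) + ∫ s in (1 / 2 : ℝ)..t, -(β • phi p (v s))
  have hw : ∀ t, HasDerivAt w (-(β • phi p (v t))) t := fun t =>
    (hphi.integral_hasStrictDerivAt (1 / 2) t).hasDerivAt.const_add _
  have hwc : Continuous w := continuous_iff_continuousAt.2 fun t => (hw t).continuousAt
  have hphiw : EqOn (fun t => phi p (deriv u t)) w (Ioo 0 1) := by
    refine isOpen_Ioo.eqOn_of_deriv_eq isPreconnected_Ioo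
      (fun t ht => (h.ode t ht).differentiableAt.differentiableWithinAt)
      (fun t _ => (hw t).differentiableAt.differentiableWithinAt) (fun t ht => ?_)
      (x := 1 / 2) ⟨by norm_num, by norm_num⟩ (by simp [w])
    rw [(h.ode t ht).deriv, (hw t).deriv, hvu t (Ioo_subset_Icc_self ht)]
  have hu : ∀ t ∈ Ioo (0 : ℝ) 1, HasDerivAt u (phi q (w t)) t := fun t ht => by
    rw [← hphiw ht, phi_phi_of_holderConjugate hpq.symm]
    exact (h.differentiableAt t ht).hasDerivAt
  refine ⟨w, isFlow_of_eq_integral hpq.symm.lt hwc (fun t ht => hvu t ht ▸ hw t) fun t ht => ?_⟩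
  rw [intervalIntegral.integral_eq_sub_of_hasDerivAt_of_le ht.1
    (h.continuousOn.mono (Icc_subset_Icc_right ht.2))
    (fun s hs => hu s (Ioo_subset_Ioo_right ht.2 hs))
    (((continuous_phi hpq.symm.lt).comp hwc).intervalIntegrable _ _), add_sub_cancel]

end Identification

/-! ### Test functions on the unit interval -/

section UnitInterval

variable {F : Type*} [NormedAddCommGroup F]

instance : IsProbabilityMeasure unitMeasure := ⟨by simp [unitMeasure]⟩

lemma unitMeasure_eq_restrict_Icc : unitMeasure = volume.restrict (Icc 0 1) :=
  Measure.restrict_congr_set Ioo_ae_eq_Icc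

lemma integral_unitMeasure [NormedSpace ℝ F] (f : ℝ → F) :
    ∫ t, f t ∂unitMeasure = ∫ t in (0 : ℝ)..1, f t := by
  rw [unitMeasure_eq_restrict_Icc, intervalIntegral.integral_of_le zero_le_one,
    integral_Icc_eq_integral_Ioc]

lemma ae_unitMeasure_mem_Ioo : ∀ᵐ t ∂unitMeasure, t ∈ Ioo (0 : ℝ) 1 :=
  ae_restrict_mem measurableSet_Ioo

lemma memLp_unitMeasure_of_continuous {f : ℝ → F} (hf : Continuous f) (r : ENNReal) :
    MemLp f r unitMeasure := by
  obtain ⟨C, hC⟩ := isCompact_Icc.exists_bound_of_continuousOn (s := Icc (0 : ℝ) 1) hf.continuousOn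
  exact MemLp.of_bound hf.aestronglyMeasurable C
    (ae_unitMeasure_mem_Ioo.mono fun t ht => hC t (Ioo_subset_Icc_self ht))

lemma integrable_unitMeasure_of_continuous {f : ℝ → F} (hf : Continuous f) :
    Integrable f unitMeasure :=
  (memLp_unitMeasure_of_continuous hf 1).integrable le_rfl

lemma integrable_unitMeasure_smul [NormedSpace ℝ F] {η : ℝ → ℝ} {f : ℝ → F}
    (hη : Continuous η) (hf : Integrable f unitMeasure) :
    Integrable (fun t => η t • f t) unitMeasure := by
  rw [unitMeasure_eq_restrict_Icc] at hf ⊢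
  exact IntegrableOn.continuousOn_smul hf hη.continuousOn isCompact_Icc

lemma intervalIntegrable_of_unitMeasure {f : ℝ → F} (hf : Integrable f unitMeasure) {t : ℝ}
    (ht : t ∈ Icc (0 : ℝ) 1) : IntervalIntegrable f volume 0 t := by
  rw [unitMeasure_eq_restrict_Icc] at hf
  rw [intervalIntegrable_iff_integrableOn_Icc_of_le ht.1]
  exact IntegrableOn.mono_set hf (Icc_subset_Icc_right ht.2)

lemma enorm_integral_le_eLpNorm [NormedSpace ℝ F] {f : ℝ → F} {r : ENNReal} (hr : 1 ≤ r)
    (hf : AEStronglyMeasurable f unitMeasure) {t : ℝ} (ht : t ∈ Icc (0 : ℝ) 1) :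
    ‖∫ s in (0 : ℝ)..t, f s‖ₑ ≤ eLpNorm f r unitMeasure :=
  calc ‖∫ s in (0 : ℝ)..t, f s‖ₑ = ‖∫ s in Ioc 0 t, f s‖ₑ := by
        rw [intervalIntegral.integral_of_le ht.1]
    _ ≤ ∫⁻ s in Ioc 0 t, ‖f s‖ₑ := enorm_integral_le_lintegral_enorm _
    _ ≤ ∫⁻ s, ‖f s‖ₑ ∂unitMeasure := by
        rw [unitMeasure_eq_restrict_Icc]
        exact lintegral_mono_set (Ioc_subset_Icc_self.trans (Icc_subset_Icc_right ht.2))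
    _ = eLpNorm f 1 unitMeasure := eLpNorm_one_eq_lintegral_enorm.symm
    _ ≤ eLpNorm f r unitMeasure := eLpNorm_le_eLpNorm_of_exponent_le hr hf

end UnitInterval

section TestFunctions

namespace IsTestFunction

variable {φ η : ℝ → E}

lemma continuous (h : IsTestFunction φ) : Continuous φ := h.smooth.continuous

lemma hasDerivAt (h : IsTestFunction φ) (t : ℝ) : HasDerivAt φ (deriv φ t) t :=
  (h.smooth.differentiable (by simp) t).hasDerivAt

lemma continuous_deriv (h : IsTestFunction φ) : Continuous (deriv φ) :=
  h.smooth.continuous_deriv (by exact_mod_cast le_top)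

lemma eq_zero_of_notMem (h : IsTestFunction φ) {t : ℝ} (ht : t ∉ Ioo (0 : ℝ) 1) : φ t = 0 :=
  image_eq_zero_of_notMem_tsupport fun h' => ht (h.tsupport_subset h')

lemma map_zero (h : IsTestFunction φ) : φ 0 = 0 := h.eq_zero_of_notMem (by simp)

lemma map_one (h : IsTestFunction φ) : φ 1 = 0 := h.eq_zero_of_notMem (by simp)

lemma sub (h : IsTestFunction φ) (h' : IsTestFunction η) : IsTestFunction fun t => φ t - η t where
  smooth := h.smooth.sub h'.smooth
  hasCompactSupport := h.hasCompactSupport.sub h'.hasCompactSupport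
  tsupport_subset := (tsupport_sub φ η).trans (union_subset h.tsupport_subset h'.tsupport_subset)

lemma smul {χ : ℝ → ℝ} (h : IsTestFunction χ) {f : ℝ → E} (hf : ContDiff ℝ (⊤ : ℕ∞) f) :
    IsTestFunction fun t => χ t • f t where
  smooth := h.smooth.smul hf
  hasCompactSupport := h.hasCompactSupport.smul_right
  tsupport_subset := (tsupport_smul_subset_left χ f).trans h.tsupport_subset

lemma integral_deriv [CompleteSpace E] (h : IsTestFunction φ) (t : ℝ) :
    ∫ s in (0 : ℝ)..t, deriv φ s = φ t := by
  rw [intervalIntegral.integral_eq_sub_of_hasDerivAt (fun s _ => h.hasDerivAt s)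
    (h.continuous_deriv.intervalIntegrable _ _), h.map_zero, sub_zero]

lemma exists_tsupport_subset_Icc (h : IsTestFunction η) :
    ∃ a b : ℝ, 0 < a ∧ b < 1 ∧ tsupport η ⊆ Icc a b := by
  have hcomp := h.hasCompactSupport.isCompact
  rcases (tsupport η).eq_empty_or_nonempty with hempty | hne
  · exact ⟨1, 0, one_pos, one_pos, by simp [hempty]⟩
  · obtain ⟨a, ha, ha'⟩ := hcomp.exists_isLeast hne
    obtain ⟨b, hb, hb'⟩ := hcomp.exists_isGreatest hne
    exact ⟨a, b, (h.tsupport_subset ha).1, (h.tsupport_subset hb).2,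
      fun x hx => ⟨ha' hx, hb' hx⟩⟩

lemma hasDerivAt_primitive [CompleteSpace E] (h : IsTestFunction η) (t : ℝ) :
    HasDerivAt (fun t => ∫ s in (0 : ℝ)..t, η s) (η t) t :=
  (h.continuous.integral_hasStrictDerivAt 0 t).hasDerivAt

lemma deriv_primitive [CompleteSpace E] (h : IsTestFunction η) :
    deriv (fun t => ∫ s in (0 : ℝ)..t, η s) = η :=
  funext fun t => (h.hasDerivAt_primitive t).deriv

lemma primitive [CompleteSpace E] (h : IsTestFunction η) (h0 : ∫ t in (0 : ℝ)..1, η t = 0) :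
    IsTestFunction fun t => ∫ s in (0 : ℝ)..t, η s := by
  obtain ⟨a, b, ha, hb, hab⟩ := h.exists_tsupport_subset_Icc
  have integral_eq_zero {c d : ℝ} (hcd : Disjoint (uIoc c d) (Icc a b)) : ∫ s in c..d, η s = 0 :=
    intervalIntegral.integral_zero_ae <| ae_of_all _ fun s hs =>
      image_eq_zero_of_notMem_tsupport fun h' => hcd.notMem_of_mem_left hs (hab h')
  have hsupp : Function.support (fun t => ∫ s in (0 : ℝ)..t, η s) ⊆ Icc a b := by
    refine Function.support_subset_iff'.2 fun t ht => ?_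
    rcases lt_or_ge t a with hta | hat
    · exact integral_eq_zero (disjoint_left.2 fun s hs hs' =>
        (hs'.1.trans hs.2).not_gt (max_lt ha hta))
    · have hbt : b < t := not_le.1 fun htb => ht ⟨hat, htb⟩
      rw [← h0, ← sub_eq_zero, intervalIntegral.integral_interval_sub_left
        (h.continuous.intervalIntegrable _ _) (h.continuous.intervalIntegrable _ _)]
      exact integral_eq_zero (disjoint_left.2 fun s hs hs' =>
        (hs.1.trans_le hs'.2).not_gt (lt_min hb hbt))
  refine ⟨?_, .of_support_subset_isCompact isCompact_Icc hsupp,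
    (closure_minimal hsupp isClosed_Icc).trans (Icc_subset_Ioo ha hb)⟩
  rw [contDiff_infty_iff_deriv, h.deriv_primitive]
  exact ⟨fun t => (h.hasDerivAt_primitive t).differentiableAt, h.smooth⟩

end IsTestFunction

lemma exists_isTestFunction_eq_one {δ : ℝ} (h0 : 0 < δ) (h1 : δ < 1 / 2) :
    ∃ χ : ℝ → ℝ, IsTestFunction χ ∧ (∀ t, χ t ∈ Icc (0 : ℝ) 1) ∧
      ∀ t ∈ Icc δ (1 - δ), χ t = 1 := by
  let f : ContDiffBump (1 / 2 : ℝ) := ⟨1 / 2 - δ, 1 / 2 - δ / 2, by linarith, by linarith⟩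
  refine ⟨f, ⟨f.contDiff, f.hasCompactSupport, ?_⟩, fun t => ⟨f.nonneg, f.le_one⟩, fun t ht => ?_⟩
  · rw [f.tsupport_eq, Real.closedBall_eq_Icc]
    exact Icc_subset_Ioo (by simp only [f]; linarith) (by simp only [f]; linarith)
  · refine f.one_of_mem_closedBall ?_
    rw [Real.closedBall_eq_Icc]
    exact ⟨by simp only [f]; linarith [ht.1], by simp only [f]; linarith [ht.2]⟩

lemma exists_isTestFunction_integral_eq_one :
    ∃ ψ : ℝ → ℝ, IsTestFunction ψ ∧ ∫ t in (0 : ℝ)..1, ψ t = 1 := by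
  let f : ContDiffBump (1 / 2 : ℝ) := ⟨1 / 8, 1 / 4, by norm_num, by norm_num⟩
  have hsupp : tsupport (f.normed volume) ⊆ Ioo (0 : ℝ) 1 := by
    rw [f.tsupport_normed_eq, Real.closedBall_eq_Icc]
    exact Icc_subset_Ioo (by norm_num [f]) (by norm_num [f])
  refine ⟨f.normed volume, ⟨f.contDiff_normed, f.hasCompactSupport_normed, hsupp⟩, ?_⟩
  rw [intervalIntegral.integral_of_le zero_le_one, setIntegral_eq_integral_of_forall_compl_eq_zero
    fun t ht => image_eq_zero_of_notMem_tsupport fun h => ht (Ioo_subset_Ioc_self (hsupp h)),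
    f.integral_normed]

lemma IsTestFunction.sub_smul_integral {η : ℝ → E} {ψ : ℝ → ℝ} (hη : IsTestFunction η)
    (hψ : IsTestFunction ψ) : IsTestFunction fun t => η t - ψ t • ∫ s in (0 : ℝ)..1, η s :=
  hη.sub (hψ.smul contDiff_const)

lemma IsTestFunction.integral_sub_smul_integral [CompleteSpace E] {η : ℝ → E} {ψ : ℝ → ℝ}
    (hη : IsTestFunction η) (hψ : IsTestFunction ψ) (hψ1 : ∫ t in (0 : ℝ)..1, ψ t = 1) :
    ∫ t in (0 : ℝ)..1, (η t - ψ t • ∫ s in (0 : ℝ)..1, η s) = 0 := by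
  rw [intervalIntegral.integral_sub (hη.continuous.intervalIntegrable _ _)
    ((hψ.smul contDiff_const).continuous.intervalIntegrable _ _),
    intervalIntegral.integral_smul_const, hψ1, one_smul, sub_self]

end TestFunctions

section WeakDerivatives

lemma hasWeakDeriv_of_hasDerivAt [CompleteSpace E] {F F' : ℝ → E}
    (hF : ∀ t, HasDerivAt F (F' t) t) (hF' : Continuous F') : HasWeakDeriv F F' where
  locallyIntegrableOn :=
    (continuous_iff_continuousAt.2 fun t =>
      (hF t).continuousAt).locallyIntegrable.locallyIntegrableOn _
  locallyIntegrableOn_deriv := hF'.locallyIntegrable.locallyIntegrableOn _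
  integral_eq φ hφ := by
    have hparts := intervalIntegral.integral_smul_deriv_eq_deriv_smul (a := 0) (b := 1)
      (fun t _ => hφ.hasDerivAt t) (fun t _ => hF t)
      (hφ.continuous_deriv.intervalIntegrable _ _) (hF'.intervalIntegrable _ _)
    rw [integral_unitMeasure, integral_unitMeasure, hparts, hφ.map_zero, hφ.map_one]
    simp

lemma HasWeakDeriv.integral_smul_eq [CompleteSpace E] {f : ℝ → E} {η ψ : ℝ → ℝ}
    (h : HasWeakDeriv f 0) (hf : Integrable f unitMeasure) (hη : IsTestFunction η)
    (hψ : IsTestFunction ψ) (hψ1 : ∫ t in (0 : ℝ)..1, ψ t = 1) :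
    ∫ t, η t • f t ∂unitMeasure = (∫ t, η t ∂unitMeasure) • ∫ t, ψ t • f t ∂unitMeasure := by
  set m := ∫ t in (0 : ℝ)..1, η t with hm
  have hζ := hη.sub_smul_integral hψ
  have htest := h.integral_eq _ (hζ.primitive (hη.integral_sub_smul_integral hψ hψ1))
  rw [hζ.deriv_primitive] at htest
  simp only [Pi.zero_apply, smul_zero, integral_zero, neg_zero, sub_smul, ← hm, smul_eq_mul,
    mul_comm _ m, mul_smul] at htest
  rwa [integral_sub (integrable_unitMeasure_smul hη.continuous hf)
    (by exact (integrable_unitMeasure_smul hψ.continuous hf).smul m), integral_smul, sub_eq_zero,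
    hm, ← integral_unitMeasure] at htest

/-- The lemma of du Bois-Reymond. -/
lemma HasWeakDeriv.exists_ae_eq_const [CompleteSpace E] {f : ℝ → E} (h : HasWeakDeriv f 0)
    (hf : Integrable f unitMeasure) : ∃ c : E, f =ᵐ[unitMeasure] fun _ => c := by
  obtain ⟨ψ, hψ, hψ1⟩ := exists_isTestFunction_integral_eq_one
  set c := ∫ t, ψ t • f t ∂unitMeasure
  have hint : Integrable (fun t => f t - c) unitMeasure := hf.sub (integrable_const c)
  have hzero := isOpen_Ioo.ae_eq_zero_of_integral_contDiff_smul_eq_zero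
    (IntegrableOn.locallyIntegrableOn hint) fun η hsmooth hcompact hsupp => by
      have hη : IsTestFunction η := ⟨hsmooth, hcompact, hsupp⟩
      rw [← setIntegral_eq_integral_of_forall_compl_eq_zero (s := Ioo 0 1)
        fun t ht => by rw [hη.eq_zero_of_notMem ht, zero_smul], ← unitMeasure]
      simp only [smul_sub]
      rw [integral_sub (integrable_unitMeasure_smul hη.continuous hf)
        ((integrable_unitMeasure_of_continuous hη.continuous).smul_const c),
        integral_smul_const, h.integral_smul_eq hf hη hψ hψ1, sub_self]
  exact ⟨c, ((ae_restrict_iff' measurableSet_Ioo).2 hzero).mono fun t ht => sub_eq_zero.1 ht⟩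

lemma HasWeakDeriv.exists_ae_eq_add_const [CompleteSpace E] {f g F F' : ℝ → E}
    (h : HasWeakDeriv f g) (hf : Integrable f unitMeasure) (hF : ∀ t, HasDerivAt F (F' t) t)
    (hF' : Continuous F') (hg : g =ᵐ[unitMeasure] F') :
    ∃ c : E, f =ᵐ[unitMeasure] fun t => F t + c := by
  have hFc : Continuous F := continuous_iff_continuousAt.2 fun t => (hF t).continuousAt
  have hFw := hasWeakDeriv_of_hasDerivAt hF hF'
  have hFi := integrable_unitMeasure_of_continuous hFc
  have hsub : HasWeakDeriv (fun t => f t - F t) 0 :=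
    { locallyIntegrableOn := h.locallyIntegrableOn.sub hFw.locallyIntegrableOn
      locallyIntegrableOn_deriv := locallyIntegrable_zero.locallyIntegrableOn _
      integral_eq := fun φ hφ => by
        have hgF : ∫ t, φ t • g t ∂unitMeasure = ∫ t, φ t • F' t ∂unitMeasure :=
          integral_congr_ae (hg.mono fun t ht => by simp only [ht])
        simp only [smul_sub]
        rw [integral_sub (integrable_unitMeasure_smul hφ.continuous_deriv hf)
          (integrable_unitMeasure_smul hφ.continuous_deriv hFi), h.integral_eq φ hφ,
          hFw.integral_eq φ hφ, hgF]
        simp }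
  obtain ⟨c, hc⟩ := hsub.exists_ae_eq_const (hf.sub hFi)
  exact ⟨c, hc.mono fun t ht => sub_eq_iff_eq_add'.1 ht⟩

end WeakDerivatives

/-! ### Weak solutions -/

section WeakSolutions

variable {p q Λ : ℝ} {u g : ℝ → E}

lemma exists_continuous_eq_integral [CompleteSpace E] (hg : Integrable g unitMeasure) :
    ∃ U : ℝ → E, Continuous U ∧ ∀ t ∈ Icc (0 : ℝ) 1, U t = ∫ s in (0 : ℝ)..t, g s := by
  rw [unitMeasure_eq_restrict_Icc] at hg
  have hcont : ContinuousOn (fun t => ∫ s in (0 : ℝ)..t, g s) (Icc 0 1) := by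
    rw [← uIcc_of_le (zero_le_one (α := ℝ))] at hg ⊢
    exact intervalIntegral.continuousOn_primitive_interval hg
  exact ⟨IccExtend zero_le_one ((Icc 0 1).domRestrict fun t => ∫ s in (0 : ℝ)..t, g s),
    hcont.domRestrict.Icc_extend', fun t ht => IccExtend_of_mem _ _ ht⟩

lemma tendsto_of_tendsto_eLpNorm_deriv [CompleteSpace E] {r : ENNReal} (hr : 1 ≤ r)
    (hg : MemLp g r unitMeasure) {φ : ℕ → ℝ → E} (hφ : ∀ n, IsTestFunction (φ n))
    (hlim : Tendsto (fun n => eLpNorm (fun t => deriv (φ n) t - g t) r unitMeasure) atTop (𝓝 0))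
    {t : ℝ} (ht : t ∈ Icc (0 : ℝ) 1) :
    Tendsto (fun n => φ n t) atTop (𝓝 (∫ s in (0 : ℝ)..t, g s)) := by
  rw [tendsto_iff_edist_tendsto_0]
  refine tendsto_of_tendsto_of_tendsto_of_le_of_le tendsto_const_nhds hlim (fun _ => zero_le)
    fun n => ?_
  have hderiv := (hφ n).continuous_deriv
  rw [edist_eq_enorm_sub, ← (hφ n).integral_deriv t, ← intervalIntegral.integral_sub
    (hderiv.intervalIntegrable _ _) (intervalIntegrable_of_unitMeasure (hg.integrable hr) ht)]
  exact enorm_integral_le_eLpNorm hr (hderiv.aestronglyMeasurable.sub hg.1) ht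

lemma MemSobolevZero.exists_primitive [CompleteSpace E] (h : MemSobolevZero p u g) (hp : 1 ≤ p) :
    ∃ U : ℝ → E, Continuous U ∧ U 0 = 0 ∧ U 1 = 0 ∧ u =ᵐ[unitMeasure] U ∧
      ∀ t ∈ Icc (0 : ℝ) 1, U t = ∫ s in (0 : ℝ)..t, g s := by
  have hr : 1 ≤ ENNReal.ofReal p := ENNReal.one_le_ofReal.2 hp
  obtain ⟨U, hU, hUg⟩ := exists_continuous_eq_integral (h.memLp_deriv.integrable hr)
  obtain ⟨φ, hφ, hφu, hφg⟩ := h.approx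
  have hφU (t : ℝ) (ht : t ∈ Icc (0 : ℝ) 1) : Tendsto (fun n => φ n t) atTop (𝓝 (U t)) :=
    hUg t ht ▸ tendsto_of_tendsto_eLpNorm_deriv hr h.memLp_deriv hφ hφg ht
  refine ⟨U, hU, ?_, ?_, ?_, hUg⟩
  · rw [hUg 0 (by simp), intervalIntegral.integral_same]
  · exact tendsto_nhds_unique (hφU 1 (by simp)) (by simp [(hφ _).map_one])
  · obtain ⟨ns, hns, hφns⟩ := (tendstoInMeasure_of_tendsto_eLpNorm (one_pos.trans_le hr).ne'
      (fun n => (hφ n).continuous.aestronglyMeasurable) h.memLp.1 hφu).exists_seq_tendsto_ae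
    filter_upwards [hφns, ae_unitMeasure_mem_Ioo] with t hut ht
    exact tendsto_nhds_unique hut ((hφU t (Ioo_subset_Icc_self ht)).comp hns.tendsto_atTop)

lemma integrable_phi (hp : 1 < p) (hg : MemLp g (ENNReal.ofReal p) unitMeasure) :
    Integrable (fun t => phi p (g t)) unitMeasure := by
  have hpow : Integrable (fun t => ‖g t‖ ^ (p - 1)) unitMeasure := by
    have := (hg.mono_exponent (ENNReal.ofReal_le_ofReal (sub_le_self p zero_le_one))
      ).integrable_norm_rpow (by simpa using hp) ENNReal.ofReal_ne_top
    rwa [ENNReal.toReal_ofReal (sub_pos.2 hp).le] at this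
  exact hpow.mono' ((continuous_phi hp).comp_aestronglyMeasurable hg.1)
    (ae_of_all _ fun t => (norm_phi hp _).le)

lemma hasWeakDeriv_phi [CompleteSpace E] (hp : 1 < p) (hu : MemLp u (ENNReal.ofReal p) unitMeasure)
    (hg : MemLp g (ENNReal.ofReal p) unitMeasure)
    (h : ∀ φ : ℝ → E, IsTestFunction φ →
      ∫ t, inner ℝ (phi p (g t)) (deriv φ t) ∂unitMeasure =
        Λ * ∫ t, inner ℝ (phi p (u t)) (φ t) ∂unitMeasure) :
    HasWeakDeriv (fun t => phi p (g t)) fun t => -(Λ • phi p (u t)) where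
  locallyIntegrableOn := IntegrableOn.locallyIntegrableOn (integrable_phi hp hg)
  locallyIntegrableOn_deriv :=
    IntegrableOn.locallyIntegrableOn ((integrable_phi hp hu).smul Λ).neg
  integral_eq φ hφ := by
    have hiu := integrable_unitMeasure_smul hφ.continuous (integrable_phi hp hu)
    have hig := integrable_unitMeasure_smul hφ.continuous_deriv (integrable_phi hp hg)
    simp only [smul_neg, smul_comm _ Λ, integral_neg, integral_smul, neg_neg]
    refine ext_inner_left ℝ fun v => ?_
    rw [← integral_inner hig, inner_smul_right, ← integral_inner hiu]
    have htest := h _ (hφ.smul (contDiff_const (c := v)))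
    simp only [deriv_smul_const (hφ.hasDerivAt _).differentiableAt, inner_smul_right] at htest
    simpa only [inner_smul_right, real_inner_comm v] using htest

lemma IsWeakSolution.exists_isFlow [CompleteSpace E] (h : IsWeakSolution p Λ u)
    (hpq : p.HolderConjugate q) :
    ∃ U w : ℝ → E, IsFlow p q 1 Λ (Icc 0 1) U w ∧ U 0 = 0 ∧ U 1 = 0 ∧ u =ᵐ[unitMeasure] U := by
  obtain ⟨g, hS, hweak⟩ := h
  obtain ⟨U, hU, hU0, hU1, huU, hUg⟩ := hS.exists_primitive hpq.lt.le
  have hF : Continuous fun t => -(Λ • phi p (U t)) :=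
    (((continuous_phi hpq.lt).comp hU).const_smul Λ).neg
  obtain ⟨c, hc⟩ := (hasWeakDeriv_phi hpq.lt hS.memLp hS.memLp_deriv hweak).exists_ae_eq_add_const
    (integrable_phi hpq.lt hS.memLp_deriv)
    (fun t => (hF.integral_hasStrictDerivAt 0 t).hasDerivAt) hF
    (huU.mono fun t ht => by simp only [ht])
  set w : ℝ → E := fun t => (∫ s in (0 : ℝ)..t, -(Λ • phi p (U s))) + c
  have hw (t : ℝ) : HasDerivAt w (-(Λ • phi p (U t))) t :=
    (hF.integral_hasStrictDerivAt 0 t).hasDerivAt.add_const c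
  have hgw : g =ᵐ[unitMeasure] fun t => phi q (w t) :=
    hc.mono fun t ht => by simp only [← ht, phi_phi_of_holderConjugate hpq.symm]
  refine ⟨U, w, isFlow_of_eq_integral hpq.symm.lt
    (continuous_iff_continuousAt.2 fun t => (hw t).continuousAt) (fun t _ => hw t)
    (fun t ht => ?_), hU0, hU1, huU⟩
  rw [hU0, zero_add, hUg t ht]
  rw [unitMeasure_eq_restrict_Icc] at hgw
  exact intervalIntegral.integral_congr_ae_restrict (ae_restrict_of_ae_restrict_of_subset
    (uIoc_of_le ht.1 ▸ Ioc_subset_Icc_self.trans (Icc_subset_Icc_right ht.2)) hgw)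

end WeakSolutions

/-! ### Density of test functions with mean zero -/

section Density

variable {g : ℝ → E} {r : ENNReal}

lemma unitMeasure_compl_Icc_le {δ : ℝ} (hδ : 0 ≤ δ) :
    unitMeasure (Icc δ (1 - δ))ᶜ ≤ ENNReal.ofReal (2 * δ) := by
  have hsub : (Icc δ (1 - δ))ᶜ ∩ Ioo 0 1 ⊆ Ioo 0 δ ∪ Ioo (1 - δ) 1 := by
    rintro t ⟨htc, ht0, ht1⟩
    rcases lt_or_ge t δ with h | h
    · exact .inl ⟨ht0, h⟩
    · exact .inr ⟨not_le.1 fun h' => htc ⟨h, h'⟩, ht1⟩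
  calc unitMeasure (Icc δ (1 - δ))ᶜ = volume ((Icc δ (1 - δ))ᶜ ∩ Ioo 0 1) :=
        Measure.restrict_apply measurableSet_Icc.compl
    _ ≤ volume (Ioo 0 δ) + volume (Ioo (1 - δ) 1) :=
        (measure_mono hsub).trans (measure_union_le _ _)
    _ = ENNReal.ofReal (2 * δ) := by
        rw [Real.volume_Ioo, Real.volume_Ioo, ← ENNReal.ofReal_add (by linarith) (by linarith)]
        ring_nf

lemma exists_isTestFunction_eLpNorm_sub_le (hr : 1 ≤ r) (hr' : r ≠ ⊤)
    (hg : MemLp g r unitMeasure) {ε : ℝ} (hε : 0 < ε) :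
    ∃ η : ℝ → E, IsTestFunction η ∧
      eLpNorm (fun t => η t - g t) r unitMeasure ≤ ENNReal.ofReal ε := by
  obtain ⟨f, -, hf, hfg⟩ := hg.exist_eLpNorm_sub_le hr' hr (half_pos hε)
  obtain ⟨δ, hδ, hgδ⟩ := hg.eLpNorm_indicator_le hr hr' (half_pos hε)
  set d := min (δ / 2) (1 / 4)
  have hd : 0 < d := lt_min (half_pos hδ) (by norm_num)
  have hd_lt : d < 1 / 2 := (min_le_right _ _).trans_lt (by norm_num)
  obtain ⟨χ, hχ, hχ01, hχ1⟩ := exists_isTestFunction_eq_one hd hd_lt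
  set S := (Icc d (1 - d))ᶜ
  have hS : unitMeasure S ≤ ENNReal.ofReal δ :=
    (unitMeasure_compl_Icc_le hd.le).trans
      (ENNReal.ofReal_le_ofReal (by linarith [min_le_left (δ / 2) (1 / 4)]))
  refine ⟨fun t => χ t • f t, hχ.smul hf, ?_⟩
  have hpoint (t : ℝ) : ‖χ t • f t - g t‖ ≤ ‖‖(g - f) t‖ + ‖S.indicator g t‖‖ := by
    rw [Real.norm_of_nonneg (by positivity), Pi.sub_apply, norm_sub_rev (g t)]
    by_cases ht : t ∈ Icc d (1 - d)
    · simp [hχ1 t ht]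
    · rw [indicator_of_mem (show t ∈ S from ht),
        show χ t • f t - g t = χ t • (f t - g t) - (1 - χ t) • g t by module]
      refine (norm_sub_le _ _).trans (add_le_add ?_ ?_) <;> rw [norm_smul]
      · exact mul_le_of_le_one_left (norm_nonneg _)
          (by rw [Real.norm_of_nonneg (hχ01 t).1]; exact (hχ01 t).2)
      · exact mul_le_of_le_one_left (norm_nonneg _)
          (by rw [Real.norm_of_nonneg (sub_nonneg.2 (hχ01 t).2)]; linarith [(hχ01 t).1])
  have hgf := hg.1.sub hf.continuous.aestronglyMeasurable
  calc eLpNorm (fun t => χ t • f t - g t) r unitMeasure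
      ≤ eLpNorm (fun t => ‖(g - f) t‖ + ‖S.indicator g t‖) r unitMeasure := eLpNorm_mono hpoint
    _ ≤ eLpNorm (g - f) r unitMeasure + eLpNorm (S.indicator g) r unitMeasure := by
        rw [← eLpNorm_norm (g - f), ← eLpNorm_norm (S.indicator g)]
        exact eLpNorm_add_le hgf.norm (hg.1.indicator measurableSet_Icc.compl).norm hr
    _ ≤ ENNReal.ofReal (ε / 2) + ENNReal.ofReal (ε / 2) :=
        add_le_add hfg (hgδ S measurableSet_Icc.compl hS)
    _ = ENNReal.ofReal ε := by
        rw [← ENNReal.ofReal_add (half_pos hε).le (half_pos hε).le, add_halves]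

lemma eLpNorm_sub_smul_integral_sub_le [CompleteSpace E] (hr : 1 ≤ r) (hg : MemLp g r unitMeasure)
    (hg0 : ∫ t in (0 : ℝ)..1, g t = 0) {η : ℝ → E} {ψ : ℝ → ℝ} (hη : Continuous η)
    (hψ : Continuous ψ) :
    eLpNorm (fun t => (η t - ψ t • ∫ s in (0 : ℝ)..1, η s) - g t) r unitMeasure ≤
      (1 + eLpNorm ψ r unitMeasure) * eLpNorm (fun t => η t - g t) r unitMeasure := by
  have hηg := hη.aestronglyMeasurable.sub hg.1
  have hmean : ‖∫ s in (0 : ℝ)..1, η s‖ₑ ≤ eLpNorm (fun t => η t - g t) r unitMeasure := by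
    rw [← sub_zero (∫ s in (0 : ℝ)..1, η s), ← hg0, ← intervalIntegral.integral_sub
      (hη.intervalIntegrable _ _)
      (intervalIntegrable_of_unitMeasure (hg.integrable hr) (by simp))]
    exact enorm_integral_le_eLpNorm hr hηg (by simp)
  set m := ∫ s in (0 : ℝ)..1, η s
  have hψm : eLpNorm (fun t => ψ t • m) r unitMeasure = ‖m‖ₑ * eLpNorm ψ r unitMeasure := by
    rw [← enorm_norm, ← eLpNorm_const_smul]
    exact eLpNorm_congr_norm_ae (ae_of_all _ fun t => by simp [norm_smul, mul_comm])
  calc eLpNorm (fun t => (η t - ψ t • m) - g t) r unitMeasure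
      = eLpNorm ((fun t => η t - g t) - fun t => ψ t • m) r unitMeasure := by
        congr 1 with t
        exact sub_right_comm _ _ _
    _ ≤ eLpNorm (fun t => η t - g t) r unitMeasure + eLpNorm (fun t => ψ t • m) r unitMeasure :=
        eLpNorm_sub_le hηg (hψ.smul continuous_const).aestronglyMeasurable hr
    _ ≤ eLpNorm (fun t => η t - g t) r unitMeasure +
          eLpNorm (fun t => η t - g t) r unitMeasure * eLpNorm ψ r unitMeasure := by
        rw [hψm]
        gcongr
    _ = (1 + eLpNorm ψ r unitMeasure) * eLpNorm (fun t => η t - g t) r unitMeasure := by ring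

lemma exists_isTestFunction_integral_eq_zero [CompleteSpace E] (hr : 1 ≤ r) (hr' : r ≠ ⊤)
    (hg : MemLp g r unitMeasure) (hg0 : ∫ t in (0 : ℝ)..1, g t = 0) :
    ∃ ζ : ℕ → ℝ → E, (∀ n, IsTestFunction (ζ n)) ∧ (∀ n, ∫ t in (0 : ℝ)..1, ζ n t = 0) ∧
      Tendsto (fun n => eLpNorm (fun t => ζ n t - g t) r unitMeasure) atTop (𝓝 0) := by
  choose η hη hηg using fun n : ℕ =>
    exists_isTestFunction_eLpNorm_sub_le hr hr' hg (Nat.one_div_pos_of_nat (α := ℝ) (n := n))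
  obtain ⟨ψ, hψ, hψ1⟩ := exists_isTestFunction_integral_eq_one
  have hηlim : Tendsto (fun n => eLpNorm (fun t => η n t - g t) r unitMeasure) atTop (𝓝 0) :=
    tendsto_of_tendsto_of_tendsto_of_le_of_le tendsto_const_nhds
      (by simpa using ENNReal.tendsto_ofReal (tendsto_one_div_add_atTop_nhds_zero_nat (𝕜 := ℝ)))
      (fun _ => zero_le) hηg
  have hbound : 1 + eLpNorm ψ r unitMeasure ≠ ⊤ :=
    ENNReal.add_ne_top.2 ⟨ENNReal.one_ne_top,
      (memLp_unitMeasure_of_continuous hψ.continuous r).eLpNorm_ne_top⟩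
  refine ⟨fun n t => η n t - ψ t • ∫ s in (0 : ℝ)..1, η n s,
    fun n => (hη n).sub_smul_integral hψ,
    fun n => (hη n).integral_sub_smul_integral hψ hψ1,
    tendsto_of_tendsto_of_tendsto_of_le_of_le tendsto_const_nhds ?_ (fun _ => zero_le)
      fun n => eLpNorm_sub_smul_integral_sub_le hr hg hg0 (hη n).continuous hψ.continuous⟩
  simpa using ENNReal.Tendsto.const_mul hηlim (.inr hbound)

lemma eLpNorm_integral_sub_integral_le [CompleteSpace E] (hr : 1 ≤ r)
    (hg : MemLp g r unitMeasure) {ζ : ℝ → E} (hζ : Continuous ζ) :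
    eLpNorm (fun t => (∫ s in (0 : ℝ)..t, ζ s) - ∫ s in (0 : ℝ)..t, g s) r unitMeasure ≤
      eLpNorm (fun t => ζ t - g t) r unitMeasure := by
  have hpoint : ∀ᵐ t ∂unitMeasure, ‖(∫ s in (0 : ℝ)..t, ζ s) - ∫ s in (0 : ℝ)..t, g s‖ₑ ≤
      eLpNorm (fun t => ζ t - g t) r unitMeasure := by
    filter_upwards [ae_unitMeasure_mem_Ioo] with t ht
    have ht' := Ioo_subset_Icc_self ht
    rw [← intervalIntegral.integral_sub (hζ.intervalIntegrable _ _)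
      (intervalIntegrable_of_unitMeasure (hg.integrable hr) ht')]
    exact enorm_integral_le_eLpNorm hr (hζ.aestronglyMeasurable.sub hg.1) ht'
  simpa using eLpNorm_le_of_ae_enorm_bound (p := r) hpoint

lemma memSobolevZero_of_hasDerivAt [CompleteSpace E] {p : ℝ} (hp : 1 ≤ p) {U G : ℝ → E}
    (hU : ∀ t, HasDerivAt U (G t) t) (hG : Continuous G) (h0 : U 0 = 0) (h1 : U 1 = 0) :
    MemSobolevZero p U G := by
  have hr : 1 ≤ ENNReal.ofReal p := ENNReal.one_le_ofReal.2 hp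
  have hUc : Continuous U := continuous_iff_continuousAt.2 fun t => (hU t).continuousAt
  have hGp := memLp_unitMeasure_of_continuous hG (ENNReal.ofReal p)
  have hUG (t : ℝ) : ∫ s in (0 : ℝ)..t, G s = U t := by
    rw [intervalIntegral.integral_eq_sub_of_hasDerivAt (fun s _ => hU s)
      (hG.intervalIntegrable _ _), h0, sub_zero]
  obtain ⟨ζ, hζ, hζ0, hζG⟩ := exists_isTestFunction_integral_eq_zero hr ENNReal.ofReal_ne_top
    hGp (by rw [hUG, h1])
  refine ⟨memLp_unitMeasure_of_continuous hUc _, hGp, hasWeakDeriv_of_hasDerivAt hU hG,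
    fun n t => ∫ s in (0 : ℝ)..t, ζ n s, fun n => (hζ n).primitive (hζ0 n), ?_, ?_⟩
  · refine tendsto_of_tendsto_of_tendsto_of_le_of_le tendsto_const_nhds hζG (fun _ => zero_le)
      fun n => ?_
    simpa only [hUG] using eLpNorm_integral_sub_integral_le hr hGp (hζ n).continuous
  · simpa only [(hζ _).deriv_primitive] using hζG

lemma IsFlow.isWeakSolution [CompleteSpace E] {p q β : ℝ} {u w : ℝ → E}
    (h : IsFlow p q 1 β univ u w) (hpq : p.HolderConjugate q) (h0 : u 0 = 0) (h1 : u 1 = 0) :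
    IsWeakSolution p β u := by
  have hu : Continuous u := continuousOn_univ.1 h.continuousOn_fst
  have hw : Continuous w := continuousOn_univ.1 h.continuousOn_snd
  refine ⟨fun t => phi q (w t), memSobolevZero_of_hasDerivAt hpq.lt.le h.hasDerivAt_fst
    ((continuous_phi hpq.symm.lt).comp hw) h0 h1, fun φ hφ => ?_⟩
  have hwφ : Continuous fun t => inner ℝ (w t) (deriv φ t) := hw.inner hφ.continuous_deriv
  have huφ : Continuous fun t => β * inner ℝ (phi p (u t)) (φ t) :=
    (((continuous_phi hpq.lt).comp hu).inner hφ.continuous).const_mul β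
  have hparts : ∫ t in (0 : ℝ)..1, (inner ℝ (w t) (deriv φ t) - β * inner ℝ (phi p (u t)) (φ t))
      = 0 := by
    rw [intervalIntegral.integral_eq_sub_of_hasDerivAt (f := fun t => inner ℝ (w t) (φ t))
      (fun t _ => by
        simpa only [inner_neg_left, real_inner_smul_left, ← sub_eq_add_neg]
          using (h.hasDerivAt_snd t).inner ℝ (hφ.hasDerivAt t))
      (by exact (hwφ.sub huφ).intervalIntegrable _ _), hφ.map_zero, hφ.map_one]
    simp
  simp only [phi_phi_of_holderConjugate hpq]
  rwa [intervalIntegral.integral_sub (hwφ.intervalIntegrable _ _) (huφ.intervalIntegrable _ _),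
    sub_eq_zero, ← integral_unitMeasure, ← integral_unitMeasure, integral_const_mul] at hparts

end Density

section Eigenvalue

variable {p q μ : ℝ} {ω : ℝ → ℝ} {u w : ℝ → E}

lemma IsFlow.omega_eq_zero (h : IsFlow p q 1 (μ ^ p) (Icc 0 1) u w) (hω : IsOmega p ω)
    (hpq : p.HolderConjugate q) (hμ : 0 < μ) (h0 : u 0 = 0) (h1 : u 1 = 0)
    (hne : ∃ t ∈ Icc (0 : ℝ) 1, u t ≠ 0) : ω μ = 0 := by
  obtain ⟨c, hc⟩ := h.exists_eq_smul_omega hω hpq hμ h0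
  obtain ⟨t, ht, hut⟩ := hne
  have hc0 : μ⁻¹ • c ≠ 0 := fun hz => hut (by rw [hc t ht, hz, smul_zero])
  have hend : ω μ • (μ⁻¹ • c) = 0 := by simpa [h1] using (hc 1 (by simp)).symm
  exact (smul_eq_zero.1 hend).resolve_right hc0

lemma IsOmega.exists_isFlow_rescale (hω : IsOmega p ω) (hpq : p.HolderConjugate q) (hμ : 0 < μ) :
    ∃ w, IsFlow p q 1 (μ ^ p) univ (fun t => ω (μ * t)) w := by
  have h := (hω.isFlow hpq).rescale hpq hμ μ
  simp only [smul_eq_mul, inv_mul_cancel₀ hμ.ne', mul_one] at h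
  exact ⟨_, h⟩

lemma IsOmega.isClassicalSolution (hω : IsOmega p ω) (hp : 1 < p) (hμ : 0 < μ) (hωμ : ω μ = 0) :
    IsClassicalSolution p (μ ^ p) fun t => ω (μ * t) := by
  have hpq := Real.HolderConjugate.conjExponent hp
  obtain ⟨w, hw⟩ := hω.exists_isFlow_rescale hpq hμ
  exact hw.isClassicalSolution hpq (by simpa using hω.zero) (by simpa using hωμ)

lemma IsOmega.isWeakSolution (hω : IsOmega p ω) (hp : 1 < p) (hμ : 0 < μ) (hωμ : ω μ = 0) :
    IsWeakSolution p (μ ^ p) fun t => ω (μ * t) := by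
  have hpq := Real.HolderConjugate.conjExponent hp
  obtain ⟨w, hw⟩ := hω.exists_isFlow_rescale hpq hμ
  exact hw.isWeakSolution hpq (by simpa using hω.zero) (by simpa using hωμ)

theorem IsClassicalSolution.eigenvalue_and_profile [CompleteSpace E]
    (hu : IsClassicalSolution p (μ ^ p) u) (hω : IsOmega p ω) (hp : 1 < p) (hμ : 0 < μ)
    (hne : ∃ t ∈ Icc (0 : ℝ) 1, u t ≠ 0) :
    ω μ = 0 ∧ ∃ c : E, ∀ t ∈ Icc (0 : ℝ) 1, u t = ω (μ * t) • (μ⁻¹ • c) := by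
  have hpq := Real.HolderConjugate.conjExponent hp
  obtain ⟨w, hw⟩ := hu.exists_isFlow hpq
  exact ⟨hw.omega_eq_zero hω hpq hμ hu.left hu.right hne,
    hw.exists_eq_smul_omega hω hpq hμ hu.left⟩

theorem IsWeakSolution.eigenvalue_and_profile [CompleteSpace E]
    (hu : IsWeakSolution p (μ ^ p) u) (hω : IsOmega p ω) (hp : 1 < p) (hμ : 0 < μ)
    (hne : ¬u =ᵐ[unitMeasure] 0) :
    ω μ = 0 ∧ ∃ c : E, ∀ᵐ t ∂unitMeasure, u t = ω (μ * t) • (μ⁻¹ • c) := by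
  have hpq := Real.HolderConjugate.conjExponent hp
  obtain ⟨U, w, hw, hU0, hU1, hU⟩ := hu.exists_isFlow hpq
  have hUne : ∃ t ∈ Icc (0 : ℝ) 1, U t ≠ 0 := by
    by_contra! hz
    refine hne (hU.trans ?_)
    filter_upwards [ae_unitMeasure_mem_Ioo] with t ht using hz t (Ioo_subset_Icc_self ht)
  obtain ⟨c, hc⟩ := hw.exists_eq_smul_omega hω hpq hμ hU0
  refine ⟨hw.omega_eq_zero hω hpq hμ hU0 hU1 hUne, c, ?_⟩
  filter_upwards [hU, ae_unitMeasure_mem_Ioo] with t hUt ht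
  rw [hUt, hc t (Ioo_subset_Icc_self ht)]

end Eigenvalue

end VectorPLaplace

open VectorPLaplace in
theorem corollary3p3_general (p : ℝ) (hp : 1 < p) :
    (∃! ω : ℝ → ℝ, IsOmega p ω) ∧
    ∀ ω : ℝ → ℝ, IsOmega p ω → ∀ (E : Type*) [NormedAddCommGroup E] [InnerProductSpace ℝ E]
      [CompleteSpace E] (Λ : ℝ), 0 < Λ →
      (∀ u : ℝ → E, IsClassicalSolution p Λ u → (∃ t ∈ Icc (0 : ℝ) 1, u t ≠ 0) →
        (∃ k : ℕ, 0 < k ∧ Λ = (k : ℝ) ^ p * lam p) ∧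
        (∃ c : E, ∀ t ∈ Icc (0 : ℝ) 1, u t = ω (Λ ^ (1 / p) * t) • ((Λ ^ (1 / p))⁻¹ • c)) ∧
        IsClassicalSolution p Λ (fun t : ℝ => ω (Λ ^ (1 / p) * t))) ∧
      (∀ u : ℝ → E, IsWeakSolution p Λ u → ¬u =ᵐ[unitMeasure] 0 →
        (∃ k : ℕ, 0 < k ∧ Λ = (k : ℝ) ^ p * lam p) ∧
        (∃ c : E, ∀ᵐ t ∂unitMeasure, u t = ω (Λ ^ (1 / p) * t) • ((Λ ^ (1 / p))⁻¹ • c)) ∧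
        IsWeakSolution p Λ (fun t : ℝ => ω (Λ ^ (1 / p) * t))) := by
  have hpq := Real.HolderConjugate.conjExponent hp
  refine ⟨existsUnique_isOmega hpq, fun ω hω E _ _ _ Λ hΛ => ?_⟩
  obtain ⟨μ, hμ, rfl⟩ : ∃ μ : ℝ, 0 < μ ∧ μ ^ p = Λ :=
    ⟨Λ ^ p⁻¹, Real.rpow_pos_of_pos hΛ _, Real.rpow_inv_rpow hΛ.le hpq.ne_zero⟩
  rw [one_div, Real.rpow_rpow_inv hμ.le hpq.ne_zero]
  refine ⟨fun u hu hne => ?_, fun u hu hne => ?_⟩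
  · obtain ⟨hωμ, hprofile⟩ := hu.eigenvalue_and_profile hω hp hμ hne
    exact ⟨hω.exists_rpow_eq hpq hμ hωμ, hprofile, hω.isClassicalSolution hp hμ hωμ⟩
  · obtain ⟨hωμ, hprofile⟩ := hu.eigenvalue_and_profile hω hp hμ hne
    exact ⟨hω.exists_rpow_eq hpq hμ hωμ, hprofile, hω.isWeakSolution hp hμ hωμ⟩

theorem corollary3p3 (p : ℝ) (hp : 1 < p) :
    (∃! ω : ℝ → ℝ, VectorPLaplace.IsOmega p ω) ∧
    ∀ ω : ℝ → ℝ, VectorPLaplace.IsOmega p ω → ∀ (N : ℕ) (Λ : ℝ), 0 < Λ →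
      (∀ u : ℝ → EuclideanSpace ℝ (Fin N),
        VectorPLaplace.IsClassicalSolution p Λ u → (∃ t ∈ Set.Icc (0 : ℝ) 1, u t ≠ 0) →
          (∃ k : ℕ, 0 < k ∧ Λ = (k : ℝ) ^ p * VectorPLaplace.lam p) ∧
          (∃ c : EuclideanSpace ℝ (Fin N), ∀ t ∈ Set.Icc (0 : ℝ) 1,
            u t = ω (Λ ^ (1 / p) * t) • ((Λ ^ (1 / p))⁻¹ • c)) ∧
          VectorPLaplace.IsClassicalSolution p Λ (fun t : ℝ => ω (Λ ^ (1 / p) * t))) ∧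
      (∀ u : ℝ → EuclideanSpace ℝ (Fin N),
        VectorPLaplace.IsWeakSolution p Λ u → ¬ (u =ᵐ[VectorPLaplace.unitMeasure] 0) →
          (∃ k : ℕ, 0 < k ∧ Λ = (k : ℝ) ^ p * VectorPLaplace.lam p) ∧
          (∃ c : EuclideanSpace ℝ (Fin N), ∀ᵐ t ∂VectorPLaplace.unitMeasure,
            u t = ω (Λ ^ (1 / p) * t) • ((Λ ^ (1 / p))⁻¹ • c)) ∧
          VectorPLaplace.IsWeakSolution p Λ (fun t : ℝ => ω (Λ ^ (1 / p) * t))) := by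
  obtain ⟨hω, h⟩ := corollary3p3_general p hp
  exact ⟨hω, fun ω hω N => h ω hω (EuclideanSpace ℝ (Fin N))⟩
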